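/- Notation. Sums over $p^m$ run over all pairs of a prime $p$ and an integer $m\ge 1$. Let $$\pi^*(x)=\tfrac12\sum_{p^m<x}\frac1m+\tfrac12\sum_{p^m\le x}\frac1m$$ be the normalized Riemann prime-counting function. For $c,\varepsilon>0$ let $$\eta_c(y)=\chi^*_{[-1,1]}(y)\,\frac{c}{2\sinh c}\,I_0\bigl(c\sqrt{1-y^2}\bigr),\qquad I_0(y)=\sum_{n\ge 0}\frac{(y/2)^{2n}}{(n!)^2},$$ where $\chi^*_A$ equals $1$ in the interior of $A$, $\tfrac12$ on its boundary and $0$ outside its closure, and put $\eta_{c,\varepsilon}(y)=\frac1\varepsilon\eta_c(y/\varepsilon)$ and $$\ell_{c,\varepsilon}(\xi)=\int_{-\infty}^{\infty}\eta_{c,\varepsilon}(t)e^{i\xi t}\,dt\quad(\xi\in\mathbb C)$$ (a dilated Logan function). Let $\lambda_{c,\varepsilon}=\ell_{c,\varepsilon}(i/2)$, $A_{c,\varepsilon}=-\ell_{c,\varepsilon}''(0)/2$, $f_k(t)=e^{t/2}/t^k$, and for $|t|>\varepsilon$ $$\phi_{x,c,\varepsilon}(t)=\lambda_{c,\varepsilon}^{-1}\Bigl[\bigl(\chi_{(-\infty,\log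 x]}\,(f_1+A_{c,\varepsilon}(f_2-2f_3))\bigr)*\eta_{c,\varepsilon}\Bigr](t),$$ where $\chi_{(-\infty,\log x]}$ is the ordinary characteristic function and $(f*g)(t)=\int_{-\infty}^\infty f(y)g(t-y)\,dy$. For $0<\varepsilon<\log 2$ the modified prime-counting function is $$\pi^*_{c,\varepsilon}(x)=\sum_{p^m}\frac{\log p}{p^{m/2}}\,\phi_{x,c,\varepsilon}(m\log p).$$ Let $\mu_{c,\varepsilon}$ be the odd function with $\mu_{c,\varepsilon}(t)=-\int_{-\infty}^t\eta_{c,\varepsilon}(\tau)\,d\tau$ for $t<0$ and $\mu_{c,\varepsilon}(0)=0$, let $\nu_{c,\varepsilon}(t)=\int_{-\infty}^t\mu_{c,\varepsilon}(\tau)\,d\tau$, and let $$M_{x,c,\varepsilon}(t)=\lambda_{c,\varepsilon}^{-1}\Bigl[\mu_{c,\varepsilon}\bigl(\log\tfrac tx\bigr)+\Bigl(\frac1{\log t}-\frac12\Bigr)\Bigl(\mu_{c,\varepsilon}\bigl(\log\tfrac tx\bigr)\log\tfrac tx-\nu_{c,\varepsilon}\bigl(\log\tfrac tx\bigr)\Bigr)\Bigr].$$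 Theorem. Let $x>e^{10}$, $c\ge 1$ and $x^{-1}<\varepsilon\le 10^{-3}$. Then the sum defining $\pi^*_{c,\varepsilon}(x)$ converges absolutely, and $$\pi^*_{c,\varepsilon}(x)=\pi^*(x)+\sum_{e^{-\varepsilon}x<p^m<e^{\varepsilon}x}\frac1m M_{x,c,\varepsilon}(p^m)+R(x,c,\varepsilon),$$ where $$|R(x,c,\varepsilon)|\le\frac{0.57\,\varepsilon^3x}{c\log(\varepsilon x)}+\frac{39\,\varepsilon^4x}{c^3}+\frac{0.13\,\varepsilon^2\log\log(2x^2)}{c}.$$ -/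

import Mathlib

open MeasureTheory

noncomputable section

namespace LoganPi

/-- Index set for sums over prime powers `p ^ m`: pairs of a prime `p` and an exponent `m ≥ 1`. -/
abbrev PP : Type := Nat.Primes × ℕ+

/-- The prime `p` of the pair, as a real number. -/
def PP.p (q : PP) : ℝ := ((q.1 : ℕ) : ℝ)

/-- The exponent `m` of the pair, as a natural number. -/
def PP.m (q : PP) : ℕ := (q.2 : ℕ)

/-- The prime power `p ^ m`, as a real number. -/
def PP.val (q : PP) : ℝ := q.p ^ q.m

/-- There are finitely many prime powers up to `y`, so the sums below with a condition that bounds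
`p ^ m` from above are finite sums. -/
theorem finite_setOf_val_le (y : ℝ) : {q : PP | q.val ≤ y}.Finite := by
  have hinj : Function.Injective (fun q : PP => ((q.1 : ℕ), (q.2 : ℕ))) := by
    rintro ⟨p, m⟩ ⟨p', m'⟩ h
    simp only [Prod.mk.injEq] at h
    exact Prod.ext (Subtype.ext h.1) (PNat.coe_injective h.2)
  refine Set.Finite.subset (((Set.finite_Iic ⌊y⌋₊).prod (Set.finite_Iic ⌊y⌋₊)).preimage
    hinj.injOn) ?_
  rintro ⟨p, m⟩ hq
  have hq' : (((p : ℕ) ^ (m : ℕ) : ℕ) : ℝ) ≤ y := by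
    simpa [PP.val, PP.p, PP.m] using hq
  have hle : (p : ℕ) ^ (m : ℕ) ≤ ⌊y⌋₊ := Nat.le_floor hq'
  have h1 : (p : ℕ) ≤ (p : ℕ) ^ (m : ℕ) := Nat.le_self_pow m.pos.ne' _
  have h2 : (m : ℕ) ≤ (p : ℕ) ^ (m : ℕ) := (Nat.lt_pow_self p.2.one_lt).le
  exact ⟨h1.trans hle, h2.trans hle⟩

open Classical in
/-- The normalized Riemann prime-counting function
`π*(x) = ½ ∑_{p^m < x} 1/m + ½ ∑_{p^m ≤ x} 1/m`. -/
def piStar (x : ℝ) : ℝ :=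
  (1 / 2) * (∑' q : PP, if q.val < x then 1 / (q.m : ℝ) else 0) +
    (1 / 2) * (∑' q : PP, if q.val ≤ x then 1 / (q.m : ℝ) else 0)

/-- The normalized characteristic function of a set of reals: `1` in the interior, `1/2` on the
boundary, `0` outside the closure. -/
def chiStar (A : Set ℝ) (t : ℝ) : ℝ :=
  (interior A).indicator (fun _ => 1) t + (frontier A).indicator (fun _ => 1 / 2) t

/-- The modified Bessel function of the first kind `I₀`. -/
def besselI0 (y : ℝ) : ℝ := ∑' n : ℕ, (y / 2) ^ (2 * n) / ((n.factorial : ℝ) ^ 2)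

/-- The kernel `η_c`, the inverse Fourier transform of the Logan function. -/
def eta1 (c y : ℝ) : ℝ :=
  chiStar (Set.Icc (-1) 1) y * (c / (2 * Real.sinh c)) * besselI0 (c * √(1 - y ^ 2))

/-- The dilated kernel `η_{c,ε}`. -/
def eta (c ε y : ℝ) : ℝ := 1 / ε * eta1 c (y / ε)

/-- The Fourier transform `ĝ(ξ) = ∫ g(t) e^{iξt} dt` at a complex argument. -/
def fourierHat (g : ℝ → ℝ) (ξ : ℂ) : ℂ :=
  ∫ t : ℝ, (g t : ℂ) * Complex.exp (Complex.I * ξ * (t : ℂ))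

/-- The dilated Logan function `ℓ_{c,ε}`, the Fourier transform of `η_{c,ε}`. -/
def ell (c ε : ℝ) (ξ : ℂ) : ℂ := fourierHat (eta c ε) ξ

/-- `λ_{c,ε} = ℓ_{c,ε}(i/2)`, which is a real number since `η_{c,ε}` is real-valued. -/
def lam (c ε : ℝ) : ℝ := (ell c ε (Complex.I / 2)).re

/-- `A_{c,ε} = -ℓ''_{c,ε}(0)/2`, which is a real number since `η_{c,ε}` is real-valued. -/
def coeffA (c ε : ℝ) : ℝ := (-(iteratedDeriv 2 (ell c ε) 0) / 2).re

/-- `f_k(t) = e^{t/2} / t^k`. -/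
def f (k : ℕ) (t : ℝ) : ℝ := Real.exp (t / 2) / t ^ k

/-- The weight function `φ_{x,c,ε}`. It is used only at `t > ε`, where the kernel keeps the
convolution away from the singularity of `f_k` at `0`. -/
def phi (x c ε t : ℝ) : ℝ :=
  (lam c ε)⁻¹ *
    convolution
      ((Set.Iic (Real.log x)).indicator
        (fun s => f 1 s + coeffA c ε * (f 2 s - 2 * f 3 s)))
      (eta c ε) (ContinuousLinearMap.mul ℝ ℝ) volume t

/-- The summand `(log p / p^{m/2}) φ_{x,c,ε}(m log p)`. -/
def piModTerm (x c ε : ℝ) (q : PP) : ℝ :=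
  Real.log q.p / q.p ^ ((q.m : ℝ) / 2) * phi x c ε ((q.m : ℝ) * Real.log q.p)

/-- The modified prime-counting function `π*_{c,ε}(x)`. -/
def piMod (c ε x : ℝ) : ℝ := ∑' q : PP, piModTerm x c ε q

/-- The odd function `μ_{c,ε}` with `μ_{c,ε}(t) = -∫_{-∞}^t η_{c,ε}` for `t < 0`. -/
def mu (c ε t : ℝ) : ℝ :=
  if t < 0 then -∫ τ in Set.Iic t, eta c ε τ
  else if 0 < t then ∫ τ in Set.Iic (-t), eta c ε τ
  else 0

/-- `ν_{c,ε}(t) = ∫_{-∞}^t μ_{c,ε}`. -/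
def nu (c ε t : ℝ) : ℝ := ∫ τ in Set.Iic t, mu c ε τ

/-- The function `M_{x,c,ε}`. -/
def bigM (x c ε t : ℝ) : ℝ :=
  (lam c ε)⁻¹ *
    (mu c ε (Real.log (t / x)) +
      (1 / Real.log t - 1 / 2) *
        (mu c ε (Real.log (t / x)) * Real.log (t / x) - nu c ε (Real.log (t / x))))

open Classical in
/-- The sum of `(1/m) M_{x,c,ε}(p^m)` over the prime powers with `e^{-ε} x < p^m < e^ε x`. -/
def shortSum (x c ε : ℝ) : ℝ :=
  ∑' q : PP, if Real.exp (-ε) * x < q.val ∧ q.val < Real.exp ε * x then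
    1 / (q.m : ℝ) * bigM x c ε q.val else 0

end LoganPi

end

/-! Put `t = log p^m` and `u = t - log x`. Substituting in the convolution turns the summand of the
modified function into `1/m` times `λ⁻¹ ∫_{y ≥ u} K(y) η(y) dy`, where, with `s = 1/t`, `K(y) =
e^{-y/2} ((1 - s y)⁻¹ + A s ((1 - s y)⁻² - 2 s (1 - s y)⁻³))`. It remains to compare this weight
with the weight 1, 1/2 or 0 that `π*` gives to `p^m`. Only three properties of `η` enter: it is an
even probability density on `[-ε, ε]`, its second moment `2A` is at most `ε²/3`, and `A ≤ ε²/(2c)`.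

If `u ≥ ε`, the integral is zero, so all sums are finite. If `u ≤ -ε`, it runs over the whole
support. In `K(y) - e^{-y/2}` the odd terms integrate to zero, and the second-order term `s (s -
1/2) y²` contributes `A s (2s - 1)`, which the leading part `A s (1 - 2s)` of the `A`-term cancels;
this is the purpose of `f₂ - 2 f₃`. Since `λ = ∫ e^{-y/2} η`, the weight is `1 + O(ε² A / t)`
(`abs_far_sub_one_le`).

If `|u| < ε`, expand `K = 1 + (s - 1/2) y + Q(y) + ...`, with `Q` even and of second order. The
half-line integrals of `η` and `y η` produce exactly the counting weight, `μ` and `μ u - ν`.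
Moreover `∫ Q η = A/4` is also the main term of `λ - 1`, so that what survives is, up to sign, a
tail of `Q`, of size at most `A/8` (`abs_near_sub_le`).

The errors are then summed. Near `x` the quantity needed is the sum of `1/m` over prime powers in an
interval of relative length about `2ε`: primes are bounded by Selberg's sieve (`card_primes_le`),
higher powers by counting integers (`sum_inv_m_near_le`). Below `x`, an elementary bound for the sum
of `1 / log p^m` is enough. `error_bound` collects the constants. -/

namespace SelbergSieveBound

/-! ### Selberg's upper-bound sieve in dimension one -/

open Finset

/-- The squarefree integers in `[1, Z]`, the support of the sieve weights. -/
def sqfreeUpTo (Z : ℕ) : Finset ℕ := (Icc 1 Z).filter Squarefree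

theorem mem_sqfreeUpTo {Z d : ℕ} : d ∈ sqfreeUpTo Z ↔ (1 ≤ d ∧ d ≤ Z) ∧ Squarefree d := by
  simp [sqfreeUpTo]

theorem mem_sqfreeUpTo_of_dvd {Z d k : ℕ} (hk : k ∈ sqfreeUpTo Z) (h : d ∣ k) :
    d ∈ sqfreeUpTo Z := by
  rw [mem_sqfreeUpTo] at *
  exact ⟨⟨Nat.pos_of_dvd_of_pos h hk.1.1, (Nat.le_of_dvd hk.1.1 h).trans hk.1.2⟩,
    hk.2.squarefree_of_dvd h⟩

/-- The sum of `1 / φ(k)` over squarefree `k ≤ Z`. -/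
noncomputable def mass (Z : ℕ) : ℝ := ∑ k ∈ sqfreeUpTo Z, ((k.totient : ℝ))⁻¹

/-- By the Euler product, `1/φ(k) = (1/k) ∏_{p ∣ k} (1 - 1/p)⁻¹` is the sum of `1/n` over all `n = k
j` with every prime factor of `j` dividing `k`. Every `n` with radical `k` has this form, and the
terms are nonnegative. -/
theorem sum_inv_le_inv_totient {k : ℕ} (hk : k ≠ 0) (S : Finset ℕ)
    (hS : ∀ n ∈ S, n ≠ 0 ∧ ∏ p ∈ n.primeFactors, p = k) :
    ∑ n ∈ S, (n : ℝ)⁻¹ ≤ ((k.totient : ℝ))⁻¹ := by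
  have hdvd : ∀ n ∈ S, k ∣ n := fun n hn => (hS n hn).2 ▸ Nat.prod_primeFactors_dvd n
  let F : ℕ →* ℝ :=
    { toFun := fun n => (n : ℝ)⁻¹
      map_one' := by simp
      map_mul' := fun a b => by push_cast; rw [mul_inv] }
  have hF : ∀ {p : ℕ}, p.Prime → ‖F p‖ < 1 := by
    intro p hp
    have : (1 : ℝ) < p := by exact_mod_cast hp.one_lt
    simp only [F, MonoidHom.coe_mk, OneHom.coe_mk, norm_inv, RCLike.norm_natCast]
    exact inv_lt_one_of_one_lt₀ this
  have key := (EulerProduct.summable_and_hasSum_factoredNumbers_prod_filter_prime_geometric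
    (f := F) hF k.primeFactors).2
  have hfil : k.primeFactors.filter Nat.Prime = k.primeFactors :=
    Finset.filter_true_of_mem fun p hp => Nat.prime_of_mem_primeFactors hp
  rw [hfil] at key
  have key2 := (hasSum_subtype_iff_indicator (f := fun n : ℕ => F n)).1 key
  have hinj : Set.InjOn (fun n => n / k) (S : Set ℕ) := by
    intro a ha b hb hab
    have := congrArg (fun j => k * j) hab
    simpa [Nat.mul_div_cancel' (hdvd a ha), Nat.mul_div_cancel' (hdvd b hb)] using this
  have hle := sum_le_hasSum (S.image (fun n => n / k)) (fun n _ => by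
    apply Set.indicator_nonneg; intro n _; simp [F]) key2
  rw [sum_image hinj] at hle
  have htot : ((k.totient : ℝ))⁻¹ = (k : ℝ)⁻¹ * ∏ p ∈ k.primeFactors, (1 - F p)⁻¹ := by
    have := Nat.totient_eq_mul_prod_factors k
    have h2 : (k.totient : ℝ) = k * ∏ p ∈ k.primeFactors, (1 - (p : ℝ)⁻¹) := by
      have h3 := congrArg (fun q : ℚ => (q : ℝ)) this
      push_cast at h3
      exact h3
    rw [h2, mul_inv, prod_inv_distrib]; rfl
  rw [htot]
  calc ∑ n ∈ S, (n : ℝ)⁻¹ = (k : ℝ)⁻¹ * ∑ n ∈ S,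
        (Nat.factoredNumbers k.primeFactors).indicator (fun n : ℕ => F n) (n / k) := by
        rw [mul_sum]
        refine sum_congr rfl fun n hn => ?_
        have hn0 := (hS n hn).1
        have hd : n / k ∣ n := Nat.div_dvd_of_dvd (hdvd n hn)
        have hnk : n / k ≠ 0 := fun h => hn0 (by simpa [h] using (Nat.mul_div_cancel' (hdvd n hn)).symm)
        have hpf : k.primeFactors = n.primeFactors := by
          rw [← (hS n hn).2]
          exact Nat.primeFactors_prod fun p hp => Nat.prime_of_mem_primeFactors hp
        have hmem : n / k ∈ Nat.factoredNumbers k.primeFactors := by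
          apply Nat.mem_factoredNumbers_of_primeFactors_subset hnk
          rw [hpf]; exact Nat.primeFactors_mono hd hn0
        rw [Set.indicator_of_mem hmem]
        simp only [F, MonoidHom.coe_mk, OneHom.coe_mk]
        rw [← mul_inv, ← Nat.cast_mul, Nat.mul_div_cancel' (hdvd n hn)]
    _ ≤ _ := by gcongr

/-- Group the harmonic sum up to `Z` by the radical of `n`, which is squarefree and at most `Z`;
each group is at most `1/φ` of the radical. -/
theorem log_le_mass (Z : ℕ) : Real.log (Z + 1) ≤ mass Z := by
  have h1 : Real.log (Z + 1) ≤ ∑ n ∈ Icc 1 Z, (n : ℝ)⁻¹ := by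
    have := log_add_one_le_harmonic Z
    rw [harmonic_eq_sum_Icc] at this
    push_cast at this
    exact_mod_cast this
  refine h1.trans ?_
  have hmaps : ∀ n ∈ Icc 1 Z, ∏ p ∈ n.primeFactors, p ∈ sqfreeUpTo Z := by
    intro n hn
    rw [mem_Icc] at hn
    have hd := Nat.prod_primeFactors_dvd n
    rw [mem_sqfreeUpTo]
    refine ⟨⟨Nat.pos_of_dvd_of_pos hd (by omega), (Nat.le_of_dvd (by omega) hd).trans hn.2⟩, ?_⟩
    rw [← Nat.radical_eq_prod_primeFactors]
    exact UniqueFactorizationMonoid.squarefree_radical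
  rw [← sum_fiberwise_of_maps_to hmaps]
  refine sum_le_sum fun k hk => ?_
  apply sum_inv_le_inv_totient (by have := (mem_sqfreeUpTo.1 hk).1.1; omega)
  intro n hn
  simp only [mem_filter, mem_Icc] at hn
  exact ⟨by omega, hn.2⟩

theorem mass_pos {Z : ℕ} (hZ : 1 ≤ Z) : 0 < mass Z := by
  refine lt_of_lt_of_le (Real.log_pos ?_) (log_le_mass Z)
  have : (1 : ℝ) ≤ Z := by exact_mod_cast hZ
  linarith

/-- Selberg's weights for the dimension one sieve of level `Z`. -/
noncomputable def weight (Z d : ℕ) : ℝ :=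
  ArithmeticFunction.moebius d * d / mass Z *
    ∑ k ∈ (sqfreeUpTo Z).filter (d ∣ ·), ((k.totient : ℝ))⁻¹

theorem weight_one {Z : ℕ} (hZ : 1 ≤ Z) : weight Z 1 = 1 := by
  have := mass_pos hZ
  simp only [weight, ArithmeticFunction.moebius_apply_one, one_dvd, filter_true]
  rw [← mass]
  field_simp
  simp

/-- For squarefree `d`, the sum of `1 / φ(l)` over the divisors `l` of `d` is `d / φ(d)`. -/
theorem sum_divisors_inv_totient {d : ℕ} (hd : Squarefree d) :
    ∑ l ∈ d.divisors, ((l.totient : ℝ))⁻¹ = d * ((d.totient : ℝ))⁻¹ := by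
  have h0 : d ≠ 0 := hd.ne_zero
  have h1 : (d : ℝ) = ∑ l ∈ d.divisors, ((d / l).totient : ℝ) := by
    rw [← Nat.cast_sum, Nat.sum_div_divisors d Nat.totient, Nat.sum_totient]
  rw [h1, sum_mul]
  refine sum_congr rfl fun l hl => ?_
  have hld := Nat.dvd_of_mem_divisors hl
  have hmul : d.totient = l.totient * (d / l).totient := by
    conv_lhs => rw [← Nat.mul_div_cancel' hld]
    apply Nat.totient_mul
    exact Nat.coprime_of_squarefree_mul (by rwa [Nat.mul_div_cancel' hld])
  have hl0 : (0 : ℝ) < l.totient := by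
    exact_mod_cast Nat.totient_pos.2 (Nat.pos_of_mem_divisors hl)
  have hl1 : (0 : ℝ) < (d / l).totient := by
    exact_mod_cast Nat.totient_pos.2
      (Nat.div_pos (Nat.le_of_dvd (by omega) hld) (Nat.pos_of_mem_divisors hl))
  rw [hmul]; push_cast; field_simp

/-- This is what bounds the weights by one. Since `d/φ(d) = ∑_{l ∣ d} 1/φ(l)`, the left side is the
sum of `1/φ(l (k/d))` over pairs `(k, l)`. The numbers `l (k/d)` are divisors of `k`, and they are
distinct because the gcd with `d` recovers `l`; so they form a part of the sum `mass Z`. -/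
theorem mul_sum_inv_totient_le_mass {Z d : ℕ} (hd : d ∈ sqfreeUpTo Z) :
    d * ∑ k ∈ (sqfreeUpTo Z).filter (d ∣ ·), ((k.totient : ℝ))⁻¹ ≤ mass Z := by
  have hdsq := (mem_sqfreeUpTo.1 hd).2
  have hdpos := (mem_sqfreeUpTo.1 hd).1.1
  have hdt : (0 : ℝ) < d.totient := by exact_mod_cast Nat.totient_pos.2 hdpos
  have hcop : ∀ k ∈ (sqfreeUpTo Z).filter (d ∣ ·), ∀ l ∈ d.divisors, Nat.Coprime l (k / d) := by
    intro k hk l hl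
    rw [mem_filter] at hk
    have h1 : Nat.Coprime d (k / d) :=
      Nat.coprime_of_squarefree_mul
        (by rw [Nat.mul_div_cancel' hk.2]; exact (mem_sqfreeUpTo.1 hk.1).2)
    exact Nat.Coprime.coprime_dvd_left (Nat.dvd_of_mem_divisors hl) h1
  have hgcd : ∀ k ∈ (sqfreeUpTo Z).filter (d ∣ ·), ∀ l ∈ d.divisors,
      Nat.gcd (l * (k / d)) d = l := by
    intro k hk l hl
    have h1 : Nat.Coprime (k / d) d :=
      (hcop k hk d (Nat.mem_divisors_self d (by omega))).symm
    rw [Nat.Coprime.gcd_mul_right_cancel _ h1]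
    exact Nat.gcd_eq_left (Nat.dvd_of_mem_divisors hl)
  have hexp : d * ∑ k ∈ (sqfreeUpTo Z).filter (d ∣ ·), ((k.totient : ℝ))⁻¹ =
      ∑ q ∈ ((sqfreeUpTo Z).filter (d ∣ ·)) ×ˢ d.divisors,
        (((q.2 * (q.1 / d)).totient : ℝ))⁻¹ := by
    rw [sum_product, mul_sum]
    refine sum_congr rfl fun k hk => ?_
    have hk' := mem_filter.1 hk
    have hkd : k.totient = d.totient * (k / d).totient := by
      conv_lhs => rw [← Nat.mul_div_cancel' hk'.2]
      exact Nat.totient_mul (hcop k hk d (Nat.mem_divisors_self d (by omega)))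
    calc (d : ℝ) * (k.totient : ℝ)⁻¹
        = (d * (d.totient : ℝ)⁻¹) * ((k / d).totient : ℝ)⁻¹ := by
          rw [hkd]; push_cast; rw [mul_inv]; ring
      _ = _ := by
          rw [← sum_divisors_inv_totient hdsq, sum_mul]
          refine sum_congr rfl fun l hl => ?_
          rw [Nat.totient_mul (hcop k hk l hl)]; push_cast; rw [mul_inv]
  rw [hexp, mass]
  have hinj : Set.InjOn (fun q : ℕ × ℕ => q.2 * (q.1 / d))
      (((sqfreeUpTo Z).filter (d ∣ ·)) ×ˢ d.divisors : Finset (ℕ × ℕ)) := by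
    rintro ⟨k, l⟩ h ⟨k', l'⟩ h' heq
    simp only [mem_coe, mem_product] at h h'
    simp only at heq
    have hl : l = l' := by rw [← hgcd k h.1 l h.2, ← hgcd k' h'.1 l' h'.2, heq]
    subst hl
    have hk : k / d = k' / d := Nat.eq_of_mul_eq_mul_left (Nat.pos_of_mem_divisors h.2) heq
    have e1 := Nat.mul_div_cancel' (mem_filter.1 h.1).2
    have e2 := Nat.mul_div_cancel' (mem_filter.1 h'.1).2
    rw [hk, e2] at e1
    rw [e1]
  rw [← sum_image (f := fun n : ℕ => ((n.totient : ℝ))⁻¹) hinj]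
  refine sum_le_sum_of_subset_of_nonneg ?_ (fun _ _ _ => by positivity)
  intro n hn
  obtain ⟨⟨k, l⟩, h, rfl⟩ := mem_image.1 hn
  rw [mem_product] at h
  have hk := mem_filter.1 h.1
  apply mem_sqfreeUpTo_of_dvd hk.1
  calc l * (k / d) ∣ d * (k / d) := Nat.mul_dvd_mul_right (Nat.dvd_of_mem_divisors h.2) _
    _ = k := Nat.mul_div_cancel' hk.2

theorem abs_weight_le_one {Z d : ℕ} (hd : d ∈ sqfreeUpTo Z) : |weight Z d| ≤ 1 := by
  have hZ : 1 ≤ Z := (mem_sqfreeUpTo.1 hd).1.1.trans (mem_sqfreeUpTo.1 hd).1.2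
  have hm := mass_pos hZ
  have hmu : |((ArithmeticFunction.moebius d : ℤ) : ℝ)| ≤ 1 := by
    exact_mod_cast ArithmeticFunction.abs_moebius_le_one (n := d)
  have hs : (0 : ℝ) ≤ d * ∑ k ∈ (sqfreeUpTo Z).filter (d ∣ ·), ((k.totient : ℝ))⁻¹ := by positivity
  have e : weight Z d = ArithmeticFunction.moebius d *
      ((d * ∑ k ∈ (sqfreeUpTo Z).filter (d ∣ ·), ((k.totient : ℝ))⁻¹) / mass Z) := by
    rw [weight]; ring
  rw [e, abs_mul, abs_of_nonneg (div_nonneg hs hm.le)]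
  have := div_le_one_of_le₀ (mul_sum_inv_totient_le_mass hd) hm.le
  exact mul_le_one₀ hmu (div_nonneg hs hm.le) this

theorem sum_moebius_between {k j : ℕ} (hj : Squarefree j) (hkj : k ∣ j) :
    ∑ d ∈ j.divisors.filter (k ∣ ·), ((ArithmeticFunction.moebius d : ℤ) : ℝ) =
      if j = k then (ArithmeticFunction.moebius k : ℝ) else 0 := by
  obtain ⟨m, rfl⟩ := hkj
  have hk0 : 0 < k := Nat.pos_of_ne_zero (left_ne_zero_of_mul hj.ne_zero)
  have hm0 : 0 < m := Nat.pos_of_ne_zero (right_ne_zero_of_mul hj.ne_zero)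
  have himg : (k * m).divisors.filter (k ∣ ·) = m.divisors.image (k * ·) := by
    ext d
    simp only [mem_filter, Nat.mem_divisors, mem_image]
    constructor
    · rintro ⟨⟨h1, -⟩, e, rfl⟩
      exact ⟨e, ⟨Nat.dvd_of_mul_dvd_mul_left hk0 h1, hm0.ne'⟩, rfl⟩
    · rintro ⟨e, ⟨h1, -⟩, rfl⟩
      exact ⟨⟨Nat.mul_dvd_mul_left k h1, hj.ne_zero⟩, dvd_mul_right _ _⟩
  rw [himg, sum_image (fun a _ b _ h => Nat.eq_of_mul_eq_mul_left hk0 h)]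
  have hcop : Nat.Coprime k m := Nat.coprime_of_squarefree_mul hj
  have h1 : ∀ e ∈ m.divisors, ((ArithmeticFunction.moebius (k * e) : ℤ) : ℝ) =
      ArithmeticFunction.moebius k * (ArithmeticFunction.moebius e : ℝ) := by
    intro e he
    rw [ArithmeticFunction.isMultiplicative_moebius.map_mul_of_coprime
      (hcop.coprime_dvd_right (Nat.dvd_of_mem_divisors he))]
    push_cast; rfl
  rw [sum_congr rfl h1, ← mul_sum]
  have h2 : ∑ e ∈ m.divisors, ((ArithmeticFunction.moebius e : ℤ) : ℝ) = if m = 1 then 1 else 0 := by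
    have := ArithmeticFunction.coe_moebius_mul_coe_zeta (R := ℝ)
    have h3 := congrArg (fun g : ArithmeticFunction ℝ => g m) this
    simp only [ArithmeticFunction.coe_mul_zeta_apply, ArithmeticFunction.one_apply,
      ArithmeticFunction.intCoe_apply] at h3
    exact h3
  rw [h2]
  have : k * m = k ↔ m = 1 := by
    constructor
    · intro h; exact Nat.eq_of_mul_eq_mul_left hk0 (by simpa using h)
    · rintro rfl; simp
  simp only [this, mul_ite, mul_one, mul_zero]

/-- Möbius inversion over multiples: the weights are defined so that, in the variables that
diagonalize the quadratic form, they take this simple value. -/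
theorem sum_weight_div {Z k : ℕ} (hk : k ∈ sqfreeUpTo Z) :
    ∑ d ∈ (sqfreeUpTo Z).filter (k ∣ ·), weight Z d / d =
      ArithmeticFunction.moebius k / (k.totient * mass Z) := by
  have h1 : ∀ d ∈ (sqfreeUpTo Z).filter (k ∣ ·), weight Z d / d =
      ∑ j ∈ (sqfreeUpTo Z), if d ∣ j then
        (mass Z)⁻¹ * (j.totient : ℝ)⁻¹ * ArithmeticFunction.moebius d else 0 := by
    intro d hd
    have hd0 : (d : ℝ) ≠ 0 := by
      have := (mem_sqfreeUpTo.1 (mem_filter.1 hd).1).1.1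
      positivity
    rw [weight, ← sum_filter, ← sum_mul, ← mul_sum]
    field_simp
  rw [sum_congr rfl h1, sum_comm]
  have h2 : ∀ j ∈ sqfreeUpTo Z, (∑ d ∈ (sqfreeUpTo Z).filter (k ∣ ·), if d ∣ j then
        (mass Z)⁻¹ * (j.totient : ℝ)⁻¹ * (ArithmeticFunction.moebius d : ℝ) else 0) =
      if j = k then (mass Z)⁻¹ * (k.totient : ℝ)⁻¹ * ArithmeticFunction.moebius k else 0 := by
    intro j hj
    have hj' := mem_sqfreeUpTo.1 hj
    rw [← sum_filter, ← mul_sum]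
    have hset : ((sqfreeUpTo Z).filter (k ∣ ·)).filter (· ∣ j) = j.divisors.filter (k ∣ ·) := by
      ext d
      simp only [mem_filter, Nat.mem_divisors]
      constructor
      · rintro ⟨⟨-, a⟩, b⟩; exact ⟨⟨b, hj'.2.ne_zero⟩, a⟩
      · rintro ⟨⟨b, -⟩, a⟩; exact ⟨⟨mem_sqfreeUpTo_of_dvd hj b, a⟩, b⟩
    rw [hset]
    by_cases hkj : k ∣ j
    · rw [sum_moebius_between hj'.2 hkj]
      split_ifs with h
      · rw [h]
      · simp
    · have : j.divisors.filter (k ∣ ·) = ∅ := by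
        apply filter_eq_empty_iff.2
        intro d hd hkd
        exact hkj (hkd.trans (Nat.dvd_of_mem_divisors hd))
      rw [this, if_neg (by rintro rfl; exact hkj dvd_rfl)]; simp
  rw [sum_congr rfl h2, sum_ite_eq' , if_pos hk]
  rw [div_eq_mul_inv, mul_inv]; ring

/-- Write `1/lcm = gcd/(d e)` and expand the gcd as the sum of `φ` over its divisors. This separates
`d` from `e`. -/
theorem inv_lcm_eq {Z d e : ℕ} (hd : d ∈ sqfreeUpTo Z) (he : e ∈ sqfreeUpTo Z) :
    ((Nat.lcm d e : ℕ) : ℝ)⁻¹ = ∑ k ∈ sqfreeUpTo Z,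
      if k ∣ d ∧ k ∣ e then (k.totient : ℝ) * ((d : ℝ)⁻¹ * (e : ℝ)⁻¹) else 0 := by
  have hd0 := (mem_sqfreeUpTo.1 hd).1.1
  have he0 := (mem_sqfreeUpTo.1 he).1.1
  have hset : (sqfreeUpTo Z).filter (fun k => k ∣ d ∧ k ∣ e) = (Nat.gcd d e).divisors := by
    ext k
    simp only [mem_filter, Nat.mem_divisors, Nat.dvd_gcd_iff]
    constructor
    · rintro ⟨-, h⟩; exact ⟨h, (Nat.gcd_pos_of_pos_left _ hd0).ne'⟩
    · rintro ⟨h, -⟩; exact ⟨mem_sqfreeUpTo_of_dvd hd h.1, h⟩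
  rw [← sum_filter, hset, ← sum_mul, ← Nat.cast_sum, Nat.sum_totient]
  have h := Nat.gcd_mul_lcm d e
  have h' : (Nat.gcd d e : ℝ) * (Nat.lcm d e : ℝ) = d * e := by exact_mod_cast h
  have hl : (Nat.lcm d e : ℝ) ≠ 0 := by
    have := Nat.lcm_pos hd0 he0; positivity
  have hd1 : (d : ℝ) ≠ 0 := by positivity
  have he1 : (e : ℝ) ≠ 0 := by positivity
  field_simp
  linarith

/-- After separation the form is `∑ φ(k) y_k²` with `y_k = μ(k) / (φ(k) mass Z)`, and `∑ 1/φ(k) =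
mass Z`. -/
theorem quadratic_form_eq {Z : ℕ} (hZ : 1 ≤ Z) :
    ∑ d ∈ sqfreeUpTo Z, ∑ e ∈ sqfreeUpTo Z, weight Z d * weight Z e * ((Nat.lcm d e : ℕ) : ℝ)⁻¹ =
      (mass Z)⁻¹ := by
  have hm := mass_pos hZ
  have h1 : ∀ d ∈ sqfreeUpTo Z, ∀ e ∈ sqfreeUpTo Z,
      weight Z d * weight Z e * ((Nat.lcm d e : ℕ) : ℝ)⁻¹ = ∑ k ∈ sqfreeUpTo Z,
        (k.totient : ℝ) * ((if k ∣ d then weight Z d / d else 0) *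
          (if k ∣ e then weight Z e / e else 0)) := by
    intro d hd e he
    rw [inv_lcm_eq hd he, mul_sum]
    refine sum_congr rfl fun k _ => ?_
    by_cases a : k ∣ d <;> by_cases b : k ∣ e <;> simp [a, b]
    ring
  rw [sum_congr rfl fun d hd => sum_congr rfl fun e he => h1 d hd e he]
  have h2 : ∑ d ∈ sqfreeUpTo Z, ∑ e ∈ sqfreeUpTo Z, ∑ k ∈ sqfreeUpTo Z,
        (k.totient : ℝ) * ((if k ∣ d then weight Z d / d else 0) *
          (if k ∣ e then weight Z e / e else 0)) =
      ∑ k ∈ sqfreeUpTo Z, (k.totient : ℝ) *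
        (∑ d ∈ (sqfreeUpTo Z).filter (k ∣ ·), weight Z d / d) ^ 2 := by
    rw [sum_congr rfl fun d _ => sum_comm, sum_comm]
    refine sum_congr rfl fun k _ => ?_
    rw [sum_filter, sq, sum_mul_sum, mul_sum]
    refine sum_congr rfl fun d _ => ?_
    rw [mul_sum]
  rw [h2]
  have h3 : ∀ k ∈ sqfreeUpTo Z, (k.totient : ℝ) *
        (∑ d ∈ (sqfreeUpTo Z).filter (k ∣ ·), weight Z d / d) ^ 2 =
      (k.totient : ℝ)⁻¹ * ((mass Z)⁻¹) ^ 2 := by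
    intro k hk
    have hk' := mem_sqfreeUpTo.1 hk
    have ht : (0 : ℝ) < k.totient := by exact_mod_cast Nat.totient_pos.2 hk'.1.1
    have hmu : ((ArithmeticFunction.moebius k : ℤ) : ℝ) ^ 2 = 1 := by
      exact_mod_cast ArithmeticFunction.moebius_sq_eq_one_of_squarefree hk'.2
    rw [sum_weight_div hk, div_pow, hmu]
    field_simp
  rw [sum_congr rfl h3, ← sum_mul, ← mass]
  field_simp

/-- Selberg's upper bound: if a finite set `S` of integers is so evenly distributed that the number
of its elements divisible by `d` differs from `X / d` by at most one, then at most
`X / log (Z + 1) + Z ^ 2` of its elements have no divisor in `[2, Z]`. -/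
theorem card_sifted_le {Z : ℕ} (hZ : 1 ≤ Z) (S T : Finset ℕ) (X : ℝ) (hX : 0 ≤ X)
    (hS : ∀ d : ℕ, 1 ≤ d → |((S.filter (d ∣ ·)).card : ℝ) - X / d| ≤ 1) (hTS : T ⊆ S)
    (hT : ∀ n ∈ T, ∀ d, 1 ≤ d → d ≤ Z → d ∣ n → d = 1) :
    (T.card : ℝ) ≤ X / Real.log (Z + 1) + (Z : ℝ) ^ 2 := by
  have hm := mass_pos hZ
  have h1mem : 1 ∈ sqfreeUpTo Z := mem_sqfreeUpTo.2 ⟨⟨le_rfl, hZ⟩, squarefree_one⟩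
  -- The squares majorize the indicator of `T`: for `n ∈ T` only `d = 1` contributes, with weight
  -- one.
  have hstep1 : (T.card : ℝ) ≤ ∑ n ∈ S, (∑ d ∈ (sqfreeUpTo Z).filter (· ∣ n), weight Z d) ^ 2 := by
    calc (T.card : ℝ) = ∑ n ∈ T, (∑ d ∈ (sqfreeUpTo Z).filter (· ∣ n), weight Z d) ^ 2 := by
          rw [card_eq_sum_ones]; push_cast
          refine sum_congr rfl fun n hn => ?_
          have : (sqfreeUpTo Z).filter (· ∣ n) = {1} := by
            ext d
            simp only [mem_filter, mem_singleton]
            constructor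
            · rintro ⟨a, b⟩
              have := mem_sqfreeUpTo.1 a
              exact hT n hn d this.1.1 this.1.2 b
            · rintro rfl; exact ⟨h1mem, one_dvd _⟩
          rw [this, sum_singleton, weight_one hZ]; simp
      _ ≤ _ := sum_le_sum_of_subset_of_nonneg hTS fun _ _ _ => by positivity
  have hstep2 : ∑ n ∈ S, (∑ d ∈ (sqfreeUpTo Z).filter (· ∣ n), weight Z d) ^ 2 =
      ∑ d ∈ sqfreeUpTo Z, ∑ e ∈ sqfreeUpTo Z, weight Z d * weight Z e *
        ((S.filter (Nat.lcm d e ∣ ·)).card : ℝ) := by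
    have : ∀ n ∈ S, (∑ d ∈ (sqfreeUpTo Z).filter (· ∣ n), weight Z d) ^ 2 =
        ∑ d ∈ sqfreeUpTo Z, ∑ e ∈ sqfreeUpTo Z,
          if Nat.lcm d e ∣ n then weight Z d * weight Z e else 0 := by
      intro n _
      rw [sq, sum_filter, sum_mul_sum]
      refine sum_congr rfl fun d _ => sum_congr rfl fun e _ => ?_
      by_cases a : d ∣ n <;> by_cases b : e ∣ n <;> simp [a, b, Nat.lcm_dvd_iff]
    rw [sum_congr rfl this, sum_comm]
    refine sum_congr rfl fun d _ => ?_
    rw [sum_comm]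
    refine sum_congr rfl fun e _ => ?_
    rw [← sum_filter, sum_const, nsmul_eq_mul, mul_comm]
  have hstep3 : ∀ d ∈ sqfreeUpTo Z, ∀ e ∈ sqfreeUpTo Z, weight Z d * weight Z e *
        ((S.filter (Nat.lcm d e ∣ ·)).card : ℝ) ≤
      X * (weight Z d * weight Z e * ((Nat.lcm d e : ℕ) : ℝ)⁻¹) + 1 := by
    intro d hd e he
    have hpos := Nat.lcm_pos (mem_sqfreeUpTo.1 hd).1.1 (mem_sqfreeUpTo.1 he).1.1
    have hb := hS _ hpos
    have hw : |weight Z d * weight Z e| ≤ 1 := by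
      rw [abs_mul]; exact mul_le_one₀ (abs_weight_le_one hd) (abs_nonneg _) (abs_weight_le_one he)
    have := (le_abs_self _).trans ((abs_mul (weight Z d * weight Z e)
      (((S.filter (Nat.lcm d e ∣ ·)).card : ℝ) - X / (Nat.lcm d e : ℕ))).le.trans
        (mul_le_one₀ hw (abs_nonneg _) hb))
    rw [div_eq_mul_inv] at this
    linarith
  have hcard : ((sqfreeUpTo Z).card : ℝ) ≤ Z := by
    have : (sqfreeUpTo Z).card ≤ (Icc 1 Z).card := card_filter_le _ _
    rw [Nat.card_Icc] at this
    exact_mod_cast this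
  calc (T.card : ℝ) ≤ _ := hstep1
    _ = _ := hstep2
    _ ≤ ∑ d ∈ sqfreeUpTo Z, ∑ e ∈ sqfreeUpTo Z,
        (X * (weight Z d * weight Z e * ((Nat.lcm d e : ℕ) : ℝ)⁻¹) + 1) :=
        sum_le_sum fun d hd => sum_le_sum fun e he => hstep3 d hd e he
    _ = X * (mass Z)⁻¹ + ((sqfreeUpTo Z).card : ℝ) ^ 2 := by
        simp only [sum_add_distrib, ← mul_sum]
        rw [quadratic_form_eq hZ]
        simp [sq]
    _ ≤ _ := by
        have hlog : 0 < Real.log (Z + 1) := Real.log_pos (by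
          have : (1 : ℝ) ≤ Z := by exact_mod_cast hZ
          linarith)
        rw [div_eq_mul_inv]
        gcongr
        exact log_le_mass Z

/-! ### Primes in short intervals -/

/-- The natural numbers in the open real interval `(a, b)`. -/
noncomputable def natsIn (a b : ℝ) : Finset ℕ := Ioo ⌊a⌋₊ ⌈b⌉₊

theorem mem_natsIn {a b : ℝ} (ha : 0 ≤ a) {n : ℕ} : n ∈ natsIn a b ↔ a < n ∧ (n : ℝ) < b := by
  rw [natsIn, mem_Ioo, Nat.floor_lt ha, Nat.lt_ceil]

theorem abs_card_natsIn_sub_le {a b : ℝ} (ha : 0 ≤ a) (hab : a < b) :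
    |((natsIn a b).card : ℝ) - (b - a)| ≤ 1 := by
  have h1 : (⌊a⌋₊ : ℝ) ≤ a := Nat.floor_le ha
  have h2 : b ≤ ⌈b⌉₊ := Nat.le_ceil b
  have h3 : a < ⌊a⌋₊ + 1 := Nat.lt_floor_add_one a
  have h4 : (⌈b⌉₊ : ℝ) < b + 1 := Nat.ceil_lt_add_one (ha.trans hab.le)
  have h5 : ⌊a⌋₊ + 1 ≤ ⌈b⌉₊ := by
    have : (⌊a⌋₊ : ℝ) < ⌈b⌉₊ := by linarith
    exact_mod_cast this
  have h6 : ((natsIn a b).card : ℝ) = ⌈b⌉₊ - ⌊a⌋₊ - 1 := by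
    rw [natsIn, Nat.card_Ioo, Nat.sub_sub, Nat.cast_sub h5]; push_cast; ring
  rw [h6, abs_le]
  constructor <;> linarith

theorem card_filter_dvd_natsIn {a b : ℝ} (ha : 0 ≤ a) {d : ℕ} (hd : 1 ≤ d) :
    ((natsIn a b).filter (d ∣ ·)).card = (natsIn (a / d) (b / d)).card := by
  have hd' : (0 : ℝ) < d := by positivity
  have : (natsIn a b).filter (d ∣ ·) = (natsIn (a / d) (b / d)).image (d * ·) := by
    ext n
    simp only [mem_filter, mem_image, mem_natsIn ha, mem_natsIn (div_nonneg ha hd'.le)]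
    constructor
    · rintro ⟨⟨h1, h2⟩, k, rfl⟩
      push_cast at h1 h2
      refine ⟨k, ⟨?_, ?_⟩, rfl⟩
      · rw [div_lt_iff₀ hd']; linarith
      · rw [lt_div_iff₀ hd']; linarith
    · rintro ⟨k, ⟨h1, h2⟩, rfl⟩
      rw [div_lt_iff₀ hd'] at h1
      rw [lt_div_iff₀ hd'] at h2
      push_cast
      exact ⟨⟨by linarith, by linarith⟩, dvd_mul_right _ _⟩
  rw [this, card_image_of_injective _ (fun a b h => Nat.eq_of_mul_eq_mul_left hd h)]

theorem mul_exp_one_le_exp (y : ℝ) : y * Real.exp 1 ≤ Real.exp y := by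
  have h := Real.add_one_le_exp (y - 1)
  have e : Real.exp y = Real.exp (y - 1) * Real.exp 1 := by rw [← Real.exp_add]; ring_nf
  rw [e]
  have := Real.exp_pos 1
  nlinarith

/-- A Brun–Titchmarsh bound: the interval `(a, b)` with `b - a ≤ κ h` contains at most
`(3 κ + 1.11) h / log h` primes, if its elements exceed `h`. -/
theorem card_primes_le {a b h κ : ℝ} (hab : a < b) (hh : 1 < h) (hha : h ≤ a)
    (hlen : b - a ≤ κ * h) (T : Finset ℕ) (hT : ∀ n ∈ T, n.Prime ∧ a < n ∧ (n : ℝ) < b) :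
    (T.card : ℝ) ≤ (3 * κ + 1.11) * h / Real.log h := by
  have ha : 0 ≤ a := by linarith
  -- The sieve has level `z = h^{1/3}`: this costs the factor 3 in `log h / 3 ≤ log (Z + 1)`, and
  -- leaves a remainder `Z² ≤ h^{2/3}`.
  set z : ℝ := Real.exp (Real.log h / 3) with hz
  have hlog : 0 < Real.log h := Real.log_pos hh
  have hz1 : 1 ≤ z := Real.one_le_exp (by positivity)
  have hz3 : z ^ 3 = h := by
    rw [hz, ← Real.exp_nat_mul]
    push_cast
    rw [mul_div_cancel₀ _ (by norm_num : (3 : ℝ) ≠ 0), Real.exp_log (by linarith)]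
  have hzh : z ≤ h := by
    rw [← hz3]; exact le_self_pow₀ hz1 (by norm_num)
  set Z : ℕ := ⌊z⌋₊ with hZ
  have hZ1 : 1 ≤ Z := by rw [hZ]; exact Nat.le_floor (by simpa using hz1)
  have hZz : (Z : ℝ) ≤ z := Nat.floor_le (by linarith)
  have hzZ : z < Z + 1 := Nat.lt_floor_add_one z
  have key := card_sifted_le hZ1 (natsIn a b) T (b - a) (by linarith)
    (fun d hd => by
      rw [card_filter_dvd_natsIn ha hd, sub_div]
      have hd' : (0 : ℝ) < d := by positivity
      exact abs_card_natsIn_sub_le (div_nonneg ha hd'.le) (by gcongr))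
    (fun n hn => (mem_natsIn ha).2 (hT n hn).2)
    (fun n hn d _ hdZ hdn => by
      rcases (Nat.dvd_prime (hT n hn).1).1 hdn with h1 | h1
      · exact h1
      · exfalso
        have h2 : (d : ℝ) ≤ Z := by exact_mod_cast hdZ
        have h3 := (hT n hn).2.1
        rw [h1] at h2
        linarith)
  have hl : Real.log h / 3 ≤ Real.log (Z + 1) := by
    rw [← Real.log_exp (Real.log h / 3)]
    exact Real.log_le_log (Real.exp_pos _) hzZ.le
  have h1 : (b - a) / Real.log (Z + 1) ≤ 3 * κ * h / Real.log h := by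
    calc (b - a) / Real.log (Z + 1) ≤ (b - a) / (Real.log h / 3) := by
          gcongr
      _ ≤ κ * h / (Real.log h / 3) := by gcongr
      _ = _ := by field_simp
  -- From `e y ≤ e^y` at `y = log h / 3` one gets `log h ≤ (3/e) z`, and `3/e < 1.11`.
  have h2 : (Z : ℝ) ^ 2 ≤ 1.11 * h / Real.log h := by
    rw [le_div_iff₀ hlog]
    have h3 := mul_exp_one_le_exp (Real.log h / 3)
    rw [← hz] at h3
    have h4 := Real.exp_one_gt_d9
    have h5 : Real.log h ≤ 1.11 * z := by nlinarith
    calc (Z : ℝ) ^ 2 * Real.log h ≤ z ^ 2 * (1.11 * z) := by gcongr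
      _ = 1.11 * h := by rw [← hz3]; ring
  calc (T.card : ℝ) ≤ _ := key
    _ ≤ 3 * κ * h / Real.log h + 1.11 * h / Real.log h := add_le_add h1 h2
    _ = _ := by ring

end SelbergSieveBound

/-! ### Sums over prime powers near and below `x` -/

namespace LoganPi

open Finset SelbergSieveBound

theorem PP.val_eq_cast (q : PP) : q.val = (((q.1 : ℕ) ^ (q.2 : ℕ) : ℕ) : ℝ) := by
  simp [PP.val, PP.p, PP.m]

theorem PP.m_pos (q : PP) : 0 < q.m := q.2.pos

theorem PP.two_le_p (q : PP) : 2 ≤ q.p := by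
  unfold PP.p; exact_mod_cast q.1.2.two_le

theorem PP.two_le_val (q : PP) : 2 ≤ q.val := by
  have h := le_self_pow₀ (show (1 : ℝ) ≤ q.p by linarith [q.two_le_p]) q.m_pos.ne'
  exact q.two_le_p.trans h

theorem PP.log_val (q : PP) : Real.log q.val = q.m * Real.log q.p := by
  rw [PP.val, Real.log_pow]

/-- By unique factorization a prime power determines its prime and exponent, so a sum over pairs can
be bounded by one over distinct integers. -/
theorem PP.pow_injective : Function.Injective fun q : PP => (q.1 : ℕ) ^ (q.2 : ℕ) := by
  rintro ⟨p, m⟩ ⟨p', m'⟩ h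
  simp only at h
  have hp : (p : ℕ) = p' := by
    have h1 : (p : ℕ) ∣ (p' : ℕ) ^ (m' : ℕ) := h ▸ dvd_pow_self _ m.pos.ne'
    exact (Nat.prime_dvd_prime_iff_eq p.2 p'.2).1 (p.2.dvd_of_dvd_pow h1)
  have hm : (m : ℕ) = m' := by
    rw [hp] at h
    exact Nat.pow_right_injective p'.2.two_le h
  exact Prod.ext (Subtype.ext hp) (PNat.coe_injective hm)

theorem exp_sub_exp_neg_le {ε : ℝ} (h0 : 0 ≤ ε) (h1 : ε ≤ 1 / 10 ^ 3) :
    Real.exp ε - Real.exp (-ε) ≤ 2.001 * ε := by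
  have hb : |ε| ≤ 1 := by rw [abs_of_nonneg h0]; norm_num at h1; linarith
  have e1 := (abs_le.1 (Real.exp_bound hb (n := 3) (by norm_num))).2
  have e2 := (abs_le.1 (Real.exp_bound (x := -ε) (by rwa [abs_neg]) (n := 3) (by norm_num))).1
  rw [abs_neg] at e2
  simp [Finset.sum_range_succ, Nat.factorial, abs_of_nonneg h0] at e1 e2
  nlinarith [mul_nonneg h0 h0, mul_nonneg (mul_nonneg h0 h0) (sub_nonneg.2 h1),
    mul_nonneg h0 (sub_nonneg.2 h1)]

/-- The number of integers whose `m`-th power lies in `(e^{-ε} x, e^ε x)`, for `m ≥ 2`. -/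
theorem card_pow_mem_le {x ε : ℝ} (hx : 1 ≤ x) (h0 : 0 < ε) (h1 : ε ≤ 1 / 10 ^ 3) {m : ℕ}
    (hm : 2 ≤ m) (T : Finset ℕ)
    (hT : ∀ n ∈ T, Real.exp (-ε) * x < (n : ℝ) ^ m ∧ (n : ℝ) ^ m < Real.exp ε * x) :
    (T.card : ℝ) ≤ 1 + 1.01 * ε * √x := by
  set y : ℝ := x ^ ((m : ℝ)⁻¹) with hy
  have hm0 : (0 : ℝ) < m := by positivity
  have hm2 : (2 : ℝ) ≤ m := by exact_mod_cast hm
  have hypos : 0 < y := by positivity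
  have hym : y ^ m = x := Real.rpow_inv_natCast_pow (by linarith) (by omega)
  have hpow : ∀ s : ℝ, (Real.exp (s / m) * y) ^ m = Real.exp s * x := by
    intro s
    rw [mul_pow, hym, ← Real.exp_nat_mul, mul_div_cancel₀ _ hm0.ne']
  have hab : Real.exp (-ε / m) * y < Real.exp (ε / m) * y := by
    gcongr; linarith
  have hsub : T ⊆ natsIn (Real.exp (-ε / m) * y) (Real.exp (ε / m) * y) := by
    intro n hn
    rw [mem_natsIn (by positivity)]
    have := hT n hn
    rw [← hpow, ← hpow] at this
    exact ⟨lt_of_pow_lt_pow_left₀ m (by positivity) this.1,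
      lt_of_pow_lt_pow_left₀ m (by positivity) this.2⟩
  have hc : (T.card : ℝ) ≤ (natsIn (Real.exp (-ε / m) * y) (Real.exp (ε / m) * y)).card := by
    exact_mod_cast card_le_card hsub
  have h2 := (abs_le.1 (abs_card_natsIn_sub_le (by positivity) hab)).2
  have hem : ε / m ≤ ε / 2 := by gcongr
  have hdiff := exp_sub_exp_neg_le (ε := ε / m) (by positivity) (by linarith)
  have hys : y ≤ √x := by
    rw [hy, Real.sqrt_eq_rpow]
    apply Real.rpow_le_rpow_of_exponent_le hx
    rw [one_div]
    gcongr
  have : (Real.exp (ε / m) - Real.exp (-(ε / m))) * y ≤ (1.01 * ε) * √x := by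
    gcongr
    linarith
  rw [neg_div] at h2 hc
  linarith

/-- Split at `√x`. Below, there are at most `√x` terms, each at most `1/log 2`, for a total of at
most `x / log x`; above, `log n ≥ (log x)/2` and there are at most `x` terms. -/
theorem sum_inv_log_le {x : ℝ} (hx : Real.exp 10 < x) (T : Finset ℕ)
    (hT : ∀ n ∈ T, 2 ≤ n ∧ (n : ℝ) ≤ x) :
    ∑ n ∈ T, (Real.log n)⁻¹ ≤ 3 * x / Real.log x := by
  have hx0 : 0 < x := (Real.exp_pos _).trans hx
  have hL : 10 < Real.log x := (Real.lt_log_iff_exp_lt hx0).2 hx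
  have hs0 : 0 < √x := Real.sqrt_pos.2 hx0
  have hss : √x * √x = x := Real.mul_self_sqrt hx0.le
  have hlog2 : 0.69 < Real.log 2 := by have := Real.log_two_gt_d9; linarith
  have hLs : Real.log √x = Real.log x / 2 := Real.log_sqrt hx0.le
  have hcard : ∀ (T : Finset ℕ) (y : ℝ), 0 ≤ y → (∀ n ∈ T, 2 ≤ n ∧ (n : ℝ) ≤ y) →
      (T.card : ℝ) ≤ y := by
    intro T y hy hT
    have : T ⊆ Icc 1 ⌊y⌋₊ := fun n hn => by
      rw [mem_Icc]; exact ⟨by have := (hT n hn).1; omega, Nat.le_floor (hT n hn).2⟩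
    have h2 := card_le_card this
    rw [Nat.card_Icc] at h2
    calc (T.card : ℝ) ≤ (⌊y⌋₊ : ℝ) := by exact_mod_cast h2
      _ ≤ y := Nat.floor_le hy
  rw [← sum_filter_add_sum_filter_not T (fun n : ℕ => (n : ℝ) ≤ √x)]
  have hA : ∑ n ∈ T.filter (fun n : ℕ => (n : ℝ) ≤ √x), (Real.log n)⁻¹ ≤ x / Real.log x := by
    have h1 : ∑ n ∈ T.filter (fun n : ℕ => (n : ℝ) ≤ √x), (Real.log n)⁻¹ ≤
        ∑ n ∈ T.filter (fun n : ℕ => (n : ℝ) ≤ √x), (0.69 : ℝ)⁻¹ := by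
      refine sum_le_sum fun n hn => ?_
      have hn2 : (2 : ℝ) ≤ n := by exact_mod_cast (hT n (mem_filter.1 hn).1).1
      have := Real.log_le_log (by norm_num) hn2
      exact inv_anti₀ (by norm_num) (by linarith)
    rw [sum_const, nsmul_eq_mul] at h1
    have h2 := hcard (T.filter (fun n : ℕ => (n : ℝ) ≤ √x)) _ hs0.le
      (fun n hn => ⟨(hT n (mem_filter.1 hn).1).1, (mem_filter.1 hn).2⟩)
    refine h1.trans ?_
    rw [le_div_iff₀ (by linarith)]
    have hexp : Real.log x / 2 * 3 ≤ √x := by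
      have := Real.quadratic_le_exp_of_nonneg (x := Real.log √x) (by rw [hLs]; linarith)
      rw [Real.exp_log hs0, hLs] at this
      nlinarith
    have h3 : Real.log x ≤ 0.69 * √x := by linarith
    calc _ ≤ √x * (0.69 : ℝ)⁻¹ * (0.69 * √x) := by gcongr
      _ = √x * √x := by ring
      _ = x := hss
  have hB : ∑ n ∈ T.filter (fun n : ℕ => ¬ (n : ℝ) ≤ √x), (Real.log n)⁻¹ ≤
      2 * x / Real.log x := by
    have h1 : ∑ n ∈ T.filter (fun n : ℕ => ¬ (n : ℝ) ≤ √x), (Real.log n)⁻¹ ≤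
        ∑ n ∈ T.filter (fun n : ℕ => ¬ (n : ℝ) ≤ √x), (Real.log x / 2)⁻¹ := by
      refine sum_le_sum fun n hn => ?_
      have hn2 := (mem_filter.1 hn).2
      push Not at hn2
      have := Real.log_le_log hs0 hn2.le
      rw [hLs] at this
      exact inv_anti₀ (by linarith) this
    rw [sum_const, nsmul_eq_mul] at h1
    have h2 := hcard (T.filter (fun n : ℕ => ¬ (n : ℝ) ≤ √x)) _ hx0.le
      (fun n hn => hT n (mem_filter.1 hn).1)
    calc _ ≤ _ := h1
      _ ≤ x * (Real.log x / 2)⁻¹ := by gcongr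
      _ = _ := by field_simp
  calc _ ≤ x / Real.log x + 2 * x / Real.log x := add_le_add hA hB
    _ = _ := by ring

/-- The sum of `1 / log n` over prime powers up to `x`. -/
theorem sum_inv_log_val_le {x : ℝ} (hx : Real.exp 10 < x) (F : Finset PP)
    (hF : ∀ q ∈ F, q.val ≤ x) :
    ∑ q ∈ F, (Real.log q.val)⁻¹ ≤ 3 * x / Real.log x := by
  have h := sum_inv_log_le hx (F.image fun q : PP => (q.1 : ℕ) ^ (q.2 : ℕ)) (by
    intro n hn
    obtain ⟨q, hq, rfl⟩ := mem_image.1 hn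
    have h1 := hF q hq
    have h2 := q.two_le_val
    rw [PP.val_eq_cast] at h1 h2
    exact ⟨by exact_mod_cast h2, h1⟩)
  rw [sum_image PP.pow_injective.injOn] at h
  simpa only [PP.val_eq_cast] using h

/-- The sum of `1 / m` over the prime powers `p ^ m` in `(e^{-ε} x, e^ε x)`. -/
theorem sum_inv_m_near_le {x ε : ℝ} (hx : Real.exp 10 < x) (hε : x⁻¹ < ε) (hε' : ε ≤ 1 / 10 ^ 3)
    (F : Finset PP) (hF : ∀ q ∈ F, Real.exp (-ε) * x < q.val ∧ q.val < Real.exp ε * x) :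
    ∑ q ∈ F, 1 / (q.m : ℝ) ≤ 7.2 * (ε * x) / Real.log (ε * x) +
      (1 + 1.01 * ε * √x) * Real.log (Real.log (2 * x ^ 2)) := by
  have hx0 : 0 < x := (Real.exp_pos _).trans hx
  have hx1 : 1 ≤ x := by have := Real.add_one_le_exp (10 : ℝ); linarith
  have hL : 10 < Real.log x := (Real.lt_log_iff_exp_lt hx0).2 hx
  have hε0 : 0 < ε := (inv_pos.2 hx0).trans hε
  have hh : 1 < ε * x := by rwa [inv_lt_iff_one_lt_mul₀ hx0] at hε
  have hlog2 : 0.69 < Real.log 2 := by have := Real.log_two_gt_d9; linarith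
  -- All exponents are at most `M`, because `m log 2 ≤ log p^m < log x + ε`. The double logarithm in
  -- the error term comes from the sum of `1/m` up to `M`.
  set M : ℕ := ⌊Real.log (2 * x ^ 2)⌋₊ with hM
  have hlog2x : Real.log (2 * x ^ 2) = Real.log 2 + 2 * Real.log x := by
    rw [Real.log_mul (by norm_num) (by positivity), Real.log_pow]; norm_num
  have hM1 : 1 ≤ M := Nat.le_floor (by rw [hlog2x]; push_cast; linarith)
  have hmaps : ∀ q ∈ F, q.m ∈ Icc 1 M := by
    intro q hq
    rw [mem_Icc]
    refine ⟨q.m_pos, Nat.le_floor ?_⟩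
    have h1 := Real.log_le_log (by linarith [q.two_le_val]) (hF q hq).2.le
    rw [q.log_val, Real.log_mul (Real.exp_pos _).ne' hx0.ne', Real.log_exp] at h1
    have h2 := Real.log_le_log (by norm_num) q.two_le_p
    have h3 : (q.m : ℝ) * 0.69 ≤ q.m * Real.log q.p := by gcongr; linarith
    rw [hlog2x]
    norm_num at hε'
    linarith
  have hcardT : ∀ m : ℕ, ((F.filter fun q => q.m = m).image fun q : PP => (q.1 : ℕ)).card =
      (F.filter fun q => q.m = m).card := by
    intro m
    apply card_image_of_injOn
    intro q hq q' hq' h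
    simp only [coe_filter, Set.mem_ofPred_eq] at hq hq'
    refine Prod.ext (Subtype.ext h) (PNat.coe_injective ?_)
    exact hq.2.trans hq'.2.symm
  rw [← sum_fiberwise_of_maps_to hmaps]
  have hinner : ∀ m ∈ Icc 1 M, ∑ q ∈ F.filter (fun q => q.m = m), 1 / (q.m : ℝ) =
      1 / (m : ℝ) * (F.filter fun q => q.m = m).card := by
    intro m _
    rw [sum_congr rfl (g := fun _ => 1 / (m : ℝ)) (fun q hq => by rw [(mem_filter.1 hq).2]),
      sum_const, nsmul_eq_mul, mul_comm]
  rw [sum_congr rfl hinner]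
  have hsplit : Icc 1 M = insert 1 (Icc 2 M) := by
    ext n; simp only [mem_Icc, mem_insert]; omega
  rw [hsplit, sum_insert (by simp)]
  refine add_le_add ?_ ?_
  · rw [← hcardT 1]
    have hexp1 : 0.99 ≤ Real.exp (-ε) := by
      have := Real.add_one_le_exp (-ε); norm_num at hε'; linarith
    have hlt : Real.exp (-ε) * x < Real.exp ε * x := by gcongr; linarith
    -- Sieve with `h = ε x`, which is below the left endpoint since `e^{-ε} ≥ 0.99 ≥ ε`. The
    -- resulting constant `3 · 2.001 + 1.11` is at most 7.2.
    have := card_primes_le (κ := 2.001) hlt hh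
      (by
        norm_num at hε'
        have : ε * x ≤ 0.99 * x := by gcongr; linarith
        refine this.trans ?_
        gcongr)
      (by
        have := exp_sub_exp_neg_le hε0.le hε'
        rw [← sub_mul, ← mul_assoc]
        gcongr)
      ((F.filter fun q => q.m = 1).image fun q : PP => (q.1 : ℕ))
      (by
        intro n hn
        obtain ⟨q, hq, rfl⟩ := mem_image.1 hn
        rw [mem_filter] at hq
        have h1 := hF q hq.1
        rw [PP.val, hq.2, pow_one] at h1
        exact ⟨q.1.2, h1⟩)
    have hlogh := Real.log_pos hh
    norm_num only [Nat.cast_one, one_div_one, one_mul]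
    refine this.trans ?_
    gcongr
    norm_num
  · have hbound : ∀ m ∈ Icc 2 M, 1 / (m : ℝ) * (F.filter fun q => q.m = m).card ≤
        (1 + 1.01 * ε * √x) * (m : ℝ)⁻¹ := by
      intro m hm
      rw [mem_Icc] at hm
      rw [← hcardT m, mul_comm, one_div]
      gcongr
      apply card_pow_mem_le hx1 hε0 hε' hm.1
      intro n hn
      obtain ⟨q, hq, rfl⟩ := mem_image.1 hn
      rw [mem_filter] at hq
      have h1 := hF q hq.1
      rw [PP.val, hq.2] at h1
      exact h1
    refine (sum_le_sum hbound).trans ?_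
    rw [← mul_sum]
    gcongr
    -- Removing `m = 1` from the harmonic sum cancels the 1 in its bound `1 + log M`.
    have h1 := harmonic_le_one_add_log M
    rw [harmonic_eq_sum_Icc, hsplit, sum_insert (by simp)] at h1
    push_cast at h1
    have h2 : Real.log M ≤ Real.log (Real.log (2 * x ^ 2)) := by
      apply Real.log_le_log (by exact_mod_cast hM1)
      exact Nat.floor_le (by rw [hlog2x]; linarith)
    norm_num at h1
    linarith

/-! ### Taylor estimates -/

theorem abs_exp_sub_quad_le {y : ℝ} (hy : |y| ≤ 1 / 10 ^ 3) :
    |Real.exp (-y / 2) - (1 - y / 2 + y ^ 2 / 8)| ≤ |y| ^ 3 / 30 := by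
  have h2 : |-y / 2| = |y| / 2 := by rw [abs_div, abs_neg]; norm_num
  have h := Real.exp_bound (x := -y / 2) (by rw [h2]; norm_num at hy; linarith) (n := 3)
    (by norm_num)
  rw [h2] at h
  simp [Finset.sum_range_succ, Nat.factorial] at h
  have e : Real.exp (-y / 2) - (1 - y / 2 + y ^ 2 / 8) =
      Real.exp (-y / 2) - (1 + -y / 2 + (-y / 2) ^ 2 / 2) := by ring
  rw [e]
  refine h.trans ?_
  have := pow_nonneg (abs_nonneg y) 3
  nlinarith

theorem abs_exp_sub_lin_le {y : ℝ} (hy : |y| ≤ 1 / 10 ^ 3) :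
    |Real.exp (-y / 2) - (1 - y / 2)| ≤ y ^ 2 / 5 := by
  have h2 : |-y / 2| = |y| / 2 := by rw [abs_div, abs_neg]; norm_num
  have h := Real.exp_bound (x := -y / 2) (by rw [h2]; norm_num at hy; linarith) (n := 2)
    (by norm_num)
  rw [h2] at h
  simp [Finset.sum_range_succ, Nat.factorial] at h
  have e : Real.exp (-y / 2) - (1 - y / 2) = Real.exp (-y / 2) - (1 + -y / 2) := by ring
  rw [e]
  refine h.trans ?_
  rw [div_pow, sq_abs]
  nlinarith [sq_nonneg y]

theorem abs_exp_sub_cubic_le {y : ℝ} (hy : |y| ≤ 1 / 10 ^ 3) :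
    |Real.exp (-y / 2) - (1 - y / 2 + y ^ 2 / 8 - y ^ 3 / 48)| ≤ y ^ 4 / 200 := by
  have h2 : |-y / 2| = |y| / 2 := by rw [abs_div, abs_neg]; norm_num
  have h := Real.exp_bound (x := -y / 2) (by rw [h2]; norm_num at hy; linarith) (n := 4)
    (by norm_num)
  rw [h2] at h
  simp [Finset.sum_range_succ, Nat.factorial] at h
  have e : Real.exp (-y / 2) - (1 - y / 2 + y ^ 2 / 8 - y ^ 3 / 48) =
      Real.exp (-y / 2) - (1 + -y / 2 + (-y / 2) ^ 2 / 2 + (-y / 2) ^ 3 / 6) := by ring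
  rw [e]
  refine h.trans ?_
  have h4 : |y| ^ 4 = y ^ 4 := by rw [← abs_pow, abs_of_nonneg (by positivity)]
  rw [div_pow, h4]
  have : 0 ≤ y ^ 4 := by positivity
  linarith

/-- Expansion of `e^{-y/2} / (1 - s y)` to second order. -/
theorem abs_exp_div_sub_le {s y : ℝ} (hs : 0 < s) (hs' : s ≤ 1.45) (hy : |y| ≤ 1 / 10 ^ 3) :
    |Real.exp (-y / 2) / (1 - s * y) - (1 + (s - 1 / 2) * y + (s ^ 2 - s / 2 + 1 / 8) * y ^ 2)| ≤
      1.01 * (1 / 30 + s * (s ^ 2 - s / 2 + 1 / 8)) * |y| ^ 3 := by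
  have hsy : |s * y| ≤ 0.00145 := by
    rw [abs_mul, abs_of_pos hs]
    calc s * |y| ≤ 1.45 * (1 / 10 ^ 3) := by gcongr
      _ = _ := by norm_num
  have hpos : 0.998 ≤ 1 - s * y := by linarith [(abs_le.1 hsy).2]
  have hb : 0 < s ^ 2 - s / 2 + 1 / 8 := by nlinarith [sq_nonneg (s - 1 / 4)]
  have h1 := abs_exp_sub_quad_le hy
  -- Multiplied by `1 - s y`, the quadratic approximation becomes `1 - y/2 + y²/8` minus a single
  -- cubic term, so the error is the Taylor remainder of the exponential plus that cubic term.
  have e : Real.exp (-y / 2) / (1 - s * y) -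
      (1 + (s - 1 / 2) * y + (s ^ 2 - s / 2 + 1 / 8) * y ^ 2) =
      ((Real.exp (-y / 2) - (1 - y / 2 + y ^ 2 / 8)) + s * (s ^ 2 - s / 2 + 1 / 8) * y ^ 3) /
        (1 - s * y) := by
    have : (1 - s * y) ≠ 0 := by linarith
    rw [eq_div_iff this, sub_mul, div_mul_cancel₀ _ this]
    ring
  rw [e, abs_div, abs_of_pos (by linarith : 0 < 1 - s * y), div_le_iff₀ (by linarith)]
  have h2 : |s * (s ^ 2 - s / 2 + 1 / 8) * y ^ 3| = s * (s ^ 2 - s / 2 + 1 / 8) * |y| ^ 3 := by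
    rw [abs_mul, abs_of_pos (by positivity), abs_pow]
  refine (abs_add_le _ _).trans ?_
  rw [h2]
  have h3 : 0 ≤ (1 / 30 + s * (s ^ 2 - s / 2 + 1 / 8)) * |y| ^ 3 := by positivity
  nlinarith

/-- Expansion of `e^{-y/2} ((1 - s y)⁻² - 2 s (1 - s y)⁻³)` to first order. -/
theorem abs_exp_mul_sub_le {s y : ℝ} (hs : 0 < s) (hs' : s ≤ 1.45) (hy : |y| ≤ 1 / 10 ^ 3) :
    |Real.exp (-y / 2) * (1 - s * y - 2 * s) / (1 - s * y) ^ 3 -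
      (1 - 2 * s + (-1 / 2 + 3 * s - 6 * s ^ 2) * y)| ≤ 32 * y ^ 2 := by
  have hsy : |s * y| ≤ 0.00145 := by
    rw [abs_mul, abs_of_pos hs]
    calc s * |y| ≤ 1.45 * (1 / 10 ^ 3) := by gcongr
      _ = _ := by norm_num
  have hsy1 := abs_le.1 hsy
  have hpos : 0.998 ≤ 1 - s * y := by linarith
  have hpos3 : 0.99 ≤ (1 - s * y) ^ 3 := by
    calc (0.99 : ℝ) ≤ 0.998 ^ 3 := by norm_num
      _ ≤ _ := by gcongr
  have h1 := abs_exp_sub_lin_le hy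
  have hy1 := abs_le.1 hy
  norm_num at hy1
  have e : Real.exp (-y / 2) * (1 - s * y - 2 * s) / (1 - s * y) ^ 3 -
      (1 - 2 * s + (-1 / 2 + 3 * s - 6 * s ^ 2) * y) =
      ((Real.exp (-y / 2) - (1 - y / 2)) * (1 - s * y - 2 * s) + y ^ 2 *
        (-s + 6 * s ^ 2 - 12 * s ^ 3 + s ^ 2 * (s * y) * (1 - 2 * s) -
          3 * s * (s * y) * (-1 / 2 + 3 * s - 6 * s ^ 2) +
            (s * y) ^ 2 * s * (-1 / 2 + 3 * s - 6 * s ^ 2))) / (1 - s * y) ^ 3 := by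
    have : (1 - s * y) ^ 3 ≠ 0 := by linarith
    rw [eq_div_iff this, sub_mul, div_mul_cancel₀ _ this]
    ring
  have hA : |(1 - s * y - 2 * s)| ≤ 2 := by rw [abs_le]; constructor <;> linarith
  have hβ : |(-1 / 2 + 3 * s - 6 * s ^ 2)| ≤ 10 := by
    rw [abs_le]; constructor <;> nlinarith
  have h12 : |1 - 2 * s| ≤ 2 := by rw [abs_le]; constructor <;> linarith
  have hmain : |-s + 6 * s ^ 2 - 12 * s ^ 3| ≤ 31 := by
    have e1 : -s + 6 * s ^ 2 - 12 * s ^ 3 = -(s * (1 - 6 * s + 12 * s ^ 2)) := by ring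
    have e2 : 0 < 1 - 6 * s + 12 * s ^ 2 := by nlinarith [sq_nonneg (s - 1 / 4)]
    have e3 : 1 - 6 * s + 12 * s ^ 2 ≤ 20 := by nlinarith
    rw [e1, abs_neg, abs_of_pos (by positivity)]
    nlinarith
  have t1 : |s ^ 2 * (s * y) * (1 - 2 * s)| ≤ 0.01 := by
    rw [abs_mul, abs_mul, abs_of_pos (by positivity : 0 < s ^ 2)]
    refine le_trans (b := 1.45 ^ 2 * 0.00145 * 2) ?_ (by norm_num)
    gcongr
  have t2 : |3 * s * (s * y) * (-1 / 2 + 3 * s - 6 * s ^ 2)| ≤ 0.1 := by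
    rw [abs_mul, abs_mul, abs_of_pos (by positivity : 0 < 3 * s)]
    refine le_trans (b := (3 * 1.45) * 0.00145 * 10) ?_ (by norm_num)
    gcongr
  have t3 : |(s * y) ^ 2 * s * (-1 / 2 + 3 * s - 6 * s ^ 2)| ≤ 0.01 := by
    rw [abs_mul, abs_mul, abs_pow, abs_of_pos hs]
    refine le_trans (b := 0.00145 ^ 2 * 1.45 * 10) ?_ (by norm_num)
    gcongr
  rw [e, abs_div, abs_of_pos (by linarith : 0 < (1 - s * y) ^ 3), div_le_iff₀ (by linarith)]
  have hB : |(-s + 6 * s ^ 2 - 12 * s ^ 3 + s ^ 2 * (s * y) * (1 - 2 * s) -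
          3 * s * (s * y) * (-1 / 2 + 3 * s - 6 * s ^ 2) +
            (s * y) ^ 2 * s * (-1 / 2 + 3 * s - 6 * s ^ 2))| ≤ 31.12 := by
    rw [abs_le] at *
    constructor <;> linarith
  calc _ ≤ |(Real.exp (-y / 2) - (1 - y / 2)) * (1 - s * y - 2 * s)| + |y ^ 2 *
        (-s + 6 * s ^ 2 - 12 * s ^ 3 + s ^ 2 * (s * y) * (1 - 2 * s) -
          3 * s * (s * y) * (-1 / 2 + 3 * s - 6 * s ^ 2) +
            (s * y) ^ 2 * s * (-1 / 2 + 3 * s - 6 * s ^ 2))| := abs_add_le _ _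
    _ ≤ y ^ 2 / 5 * 2 + y ^ 2 * 31.12 := by
        rw [abs_mul, abs_mul (y ^ 2), abs_of_nonneg (sq_nonneg y)]
        gcongr
    _ ≤ 32 * y ^ 2 * 0.99 := by nlinarith [sq_nonneg y]
    _ ≤ _ := by gcongr

/-! ### Even kernels with small support -/

/-- A nonnegative even kernel of mass one, supported in `[-ε, ε]`, whose second moment is at most
that of the uniform distribution. -/
structure IsKernel (η : ℝ → ℝ) (ε : ℝ) : Prop where
  integrable : Integrable η
  nonneg : ∀ y, 0 ≤ η y
  even : ∀ y, η (-y) = η y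
  supp : ∀ y, ε < |y| → η y = 0
  mass : ∫ y, η y = 1
  second : ∫ y, y ^ 2 * η y ≤ ε ^ 2 / 3

namespace IsKernel

variable {η : ℝ → ℝ} {ε : ℝ}

theorem integrable_mul (hk : IsKernel η ε) {g : ℝ → ℝ} (hg : Measurable g) (C : ℝ)
    (hC : ∀ y, |y| ≤ ε → |g y| ≤ C) : Integrable fun y => g y * η y := by
  refine Integrable.mono' (hk.integrable.const_mul C)
    (hg.aestronglyMeasurable.mul hk.integrable.aestronglyMeasurable) ?_
  refine Filter.Eventually.of_forall fun y => ?_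
  rw [Real.norm_eq_abs, abs_mul, abs_of_nonneg (hk.nonneg y)]
  by_cases hy : |y| ≤ ε
  · exact mul_le_mul_of_nonneg_right (hC y hy) (hk.nonneg y)
  · rw [hk.supp y (not_le.1 hy)]; simp

theorem integrable_of_continuous (hk : IsKernel η ε) {g : ℝ → ℝ} (hg : Continuous g) :
    Integrable fun y => g y * η y := by
  obtain ⟨C, hC⟩ := (isCompact_Icc (a := -ε) (b := ε)).exists_bound_of_continuousOn hg.continuousOn
  exact hk.integrable_mul hg.measurable C fun y hy => hC y (abs_le.1 hy)

theorem integral_odd (hk : IsKernel η ε) {g : ℝ → ℝ} (hg : ∀ y, g (-y) = -g y) :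
    ∫ y, g y * η y = 0 := by
  have h := integral_neg_eq_self (fun y => g y * η y) volume
  simp only [hg, hk.even, neg_mul, integral_neg] at h
  linarith

theorem setIntegral_mono (hk : IsKernel η ε) {g₁ g₂ : ℝ → ℝ} (s : Set ℝ) (hs : MeasurableSet s)
    (h₁ : Integrable fun y => g₁ y * η y) (h₂ : Integrable fun y => g₂ y * η y)
    (h : ∀ y ∈ s, |y| ≤ ε → g₁ y ≤ g₂ y) : ∫ y in s, g₁ y * η y ≤ ∫ y in s, g₂ y * η y := by
  refine setIntegral_mono_on h₁.integrableOn h₂.integrableOn hs fun y hys => ?_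
  by_cases hy : |y| ≤ ε
  · exact mul_le_mul_of_nonneg_right (h y hys hy) (hk.nonneg y)
  · rw [hk.supp y (not_le.1 hy)]; simp

/-- An integral over a set is dominated by that of a nonnegative majorant over the line. -/
theorem abs_setIntegral_le (hk : IsKernel η ε) {g₁ g₂ : ℝ → ℝ} (s : Set ℝ) (hs : MeasurableSet s)
    (h₁ : Integrable fun y => g₁ y * η y) (h₂ : Continuous g₂) (h0 : ∀ y, 0 ≤ g₂ y)
    (h : ∀ y, |y| ≤ ε → |g₁ y| ≤ g₂ y) : |∫ y in s, g₁ y * η y| ≤ ∫ y, g₂ y * η y := by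
  have i2 := hk.integrable_of_continuous h₂
  have hup := hk.setIntegral_mono s hs h₁ i2 fun y _ hy => (le_abs_self _).trans (h y hy)
  have hlo := hk.setIntegral_mono s hs (g₁ := fun y => -g₁ y) (by simpa using h₁.neg) i2
    fun y _ hy => (neg_le_abs _).trans (h y hy)
  simp only [neg_mul, integral_neg] at hlo
  have hset : ∫ y in s, g₂ y * η y ≤ ∫ y, g₂ y * η y :=
    setIntegral_le_integral i2
      (Filter.Eventually.of_forall fun y => mul_nonneg (h0 y) (hk.nonneg y))
  rw [abs_le]
  constructor <;> linarith

theorem abs_integral_le (hk : IsKernel η ε) {g₁ g₂ : ℝ → ℝ}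
    (h₁ : Integrable fun y => g₁ y * η y) (h₂ : Continuous g₂) (h0 : ∀ y, 0 ≤ g₂ y)
    (h : ∀ y, |y| ≤ ε → |g₁ y| ≤ g₂ y) : |∫ y, g₁ y * η y| ≤ ∫ y, g₂ y * η y := by
  simpa using hk.abs_setIntegral_le Set.univ MeasurableSet.univ h₁ h₂ h0 h

theorem integral_second_nonneg (hk : IsKernel η ε) : 0 ≤ ∫ y, y ^ 2 * η y :=
  integral_nonneg fun y => mul_nonneg (sq_nonneg y) (hk.nonneg y)

theorem integral_pow_four_le (hk : IsKernel η ε) :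
    ∫ y, y ^ 4 * η y ≤ ε ^ 2 * ∫ y, y ^ 2 * η y := by
  rw [← integral_const_mul]
  have h := hk.setIntegral_mono (g₁ := fun y => y ^ 4) (g₂ := fun y => ε ^ 2 * y ^ 2) Set.univ
    MeasurableSet.univ (hk.integrable_of_continuous (by fun_prop))
    (hk.integrable_of_continuous (by fun_prop)) (fun y _ hy => by
      have : y ^ 2 ≤ ε ^ 2 := sq_le_sq' (by linarith [(abs_le.1 hy).1]) (abs_le.1 hy).2
      nlinarith [sq_nonneg y])
  simpa [mul_assoc] using h

theorem integral_comp_neg_Ici (hk : IsKernel η ε) (g : ℝ → ℝ) (u : ℝ) :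
    ∫ y in Set.Ici u, g y * η y = ∫ y in Set.Iic (-u), g (-y) * η y := by
  rw [integral_Ici_eq_integral_Ioi, ← neg_neg u, ← integral_comp_neg_Iic, neg_neg]
  simp only [hk.even]

/-- `λ = ∫ e^{-y/2} η` agrees with `1 + A / 4` to fourth order, where `A` is half the second
moment. -/
theorem abs_integral_exp_sub_le (hk : IsKernel η ε) (h1 : ε ≤ 1 / 10 ^ 3) :
    |(∫ y, Real.exp (-y / 2) * η y) - 1 - (∫ y, y ^ 2 * η y) / 8| ≤
      ε ^ 2 * (∫ y, y ^ 2 * η y) / 200 := by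
  have i0 : Integrable fun y => Real.exp (-y / 2) * η y :=
    hk.integrable_of_continuous (by fun_prop)
  have iy : Integrable fun y => y * η y := hk.integrable_of_continuous (by fun_prop)
  have i2 : Integrable fun y => y ^ 2 * η y := hk.integrable_of_continuous (by fun_prop)
  have i3 : Integrable fun y => y ^ 3 * η y := hk.integrable_of_continuous (by fun_prop)
  have hexp : ∫ y, (Real.exp (-y / 2) - (1 - y / 2 + y ^ 2 / 8 - y ^ 3 / 48)) * η y =
      (∫ y, Real.exp (-y / 2) * η y) - 1 - (∫ y, y ^ 2 * η y) / 8 := by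
    have e : (fun y => (Real.exp (-y / 2) - (1 - y / 2 + y ^ 2 / 8 - y ^ 3 / 48)) * η y) =
        fun y => Real.exp (-y / 2) * η y - (η y - 1 / 2 * (y * η y) + 1 / 8 * (y ^ 2 * η y)
          - 1 / 48 * (y ^ 3 * η y)) := by
      funext y; ring
    have ieta := hk.integrable
    rw [e, integral_sub i0 (by fun_prop), integral_sub (by fun_prop) (by fun_prop),
      integral_add (by fun_prop) (by fun_prop), integral_sub (by fun_prop) (by fun_prop),
      integral_const_mul, integral_const_mul, integral_const_mul, hk.mass,
      hk.integral_odd (g := fun y => y) (fun y => rfl),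
      hk.integral_odd (g := fun y => y ^ 3) (fun y => by ring)]
    ring
  rw [← hexp]
  have h := hk.abs_integral_le
    (g₁ := fun y => Real.exp (-y / 2) - (1 - y / 2 + y ^ 2 / 8 - y ^ 3 / 48))
    (g₂ := fun y => y ^ 4 / 200) (hk.integrable_of_continuous (by fun_prop)) (by fun_prop)
    (fun y => by positivity) (fun y hy => abs_exp_sub_cubic_le (hy.trans h1))
  refine h.trans ?_
  have e2 : (fun y => y ^ 4 / 200 * η y) = fun y => 1 / 200 * (y ^ 4 * η y) := by
    funext y; ring
  rw [e2, integral_const_mul]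
  have := hk.integral_pow_four_le
  linarith

/-- The gain of an eighth of the second moment exceeds the fourth-order error. Hence division by `λ`
never enlarges an error term. -/
theorem one_le_integral_exp (hk : IsKernel η ε) (h0 : 0 ≤ ε) (h1 : ε ≤ 1 / 10 ^ 3) :
    1 ≤ ∫ y, Real.exp (-y / 2) * η y := by
  have h := (abs_le.1 (hk.abs_integral_exp_sub_le h1)).1
  have h2 := hk.integral_second_nonneg
  have h3 : ε ^ 2 ≤ 1 := by norm_num at h1; nlinarith
  nlinarith

end IsKernel

/-! ### The transfer kernel and its integral over the whole support -/

/-- The integrand `t e^{-t/2} e^{(t-y)/2} (1/(t-y) + A (1/(t-y)^2 - 2/(t-y)^3))`, in terms of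
`s = 1 / t`. -/
noncomputable def transferKernel (s A y : ℝ) : ℝ :=
  Real.exp (-y / 2) / (1 - s * y) +
    A * s * (Real.exp (-y / 2) * (1 - s * y - 2 * s) / (1 - s * y) ^ 3)

theorem transferKernel_inv_eq {t y : ℝ} (A : ℝ) (ht : t ≠ 0) (hty : t - y ≠ 0) :
    transferKernel t⁻¹ A y = t * Real.exp (-t / 2) * (f 1 (t - y) +
      A * (f 2 (t - y) - 2 * f 3 (t - y))) := by
  have hexp : Real.exp (-y / 2) = Real.exp (-t / 2) * Real.exp ((t - y) / 2) := by
    rw [← Real.exp_add]; ring_nf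
  have h1 : 1 - t⁻¹ * y = (t - y) / t := by field_simp
  simp only [transferKernel, f, h1, hexp]
  generalize Real.exp (-t / 2) = a
  generalize Real.exp ((t - y) / 2) = b
  generalize hz : t - y = z at *
  field_simp

theorem measurable_transferKernel (s A : ℝ) : Measurable (transferKernel s A) := by
  unfold transferKernel
  fun_prop

/-- A crude bound, needed only for integrability against `η`. -/
theorem abs_transferKernel_le {s A y : ℝ} (hs : 0 < s) (hs' : s ≤ 1.45) (hA : 0 ≤ A)
    (hy : |y| ≤ 1 / 10 ^ 3) : |transferKernel s A y| ≤ 100 + A * 100 := by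
  have h1 := abs_exp_div_sub_le hs hs' hy
  have h2 := abs_exp_mul_sub_le hs hs' hy
  have hsy : |s * y| ≤ 0.00145 := by
    rw [abs_mul, abs_of_pos hs]
    calc s * |y| ≤ 1.45 * (1 / 10 ^ 3) := by gcongr
      _ = _ := by norm_num
  have hpos : 0.998 ≤ 1 - s * y := by linarith [(abs_le.1 hsy).2]
  have hpos3 : 0.99 ≤ (1 - s * y) ^ 3 := by
    calc (0.99 : ℝ) ≤ 0.998 ^ 3 := by norm_num
      _ ≤ _ := by gcongr
  have hw : Real.exp (-y / 2) ≤ 2 := by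
    have hy1 := abs_le.1 hy
    norm_num at hy1
    have h := (abs_le.1 (abs_exp_sub_lin_le hy)).2
    nlinarith
  have hD2 : |1 - s * y - 2 * s| ≤ 4 := by
    have := abs_le.1 hsy
    rw [abs_le]; constructor <;> linarith
  have e1 : |Real.exp (-y / 2) / (1 - s * y)| ≤ 4 := by
    rw [abs_div, abs_of_pos (Real.exp_pos _), abs_of_pos (by linarith), div_le_iff₀ (by linarith)]
    linarith
  have e2 : |Real.exp (-y / 2) * (1 - s * y - 2 * s) / (1 - s * y) ^ 3| ≤ 10 := by
    rw [abs_div, abs_of_pos (by linarith : 0 < (1 - s * y) ^ 3), div_le_iff₀ (by linarith), abs_mul,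
      abs_of_pos (Real.exp_pos _)]
    calc _ ≤ 2 * (4 : ℝ) := by gcongr
      _ ≤ _ := by linarith
  unfold transferKernel
  refine (abs_add_le _ _).trans ?_
  rw [abs_mul (A * s), abs_of_nonneg (by positivity : 0 ≤ A * s)]
  have : A * s * |Real.exp (-y / 2) * (1 - s * y - 2 * s) / (1 - s * y) ^ 3| ≤ A * 1.45 * 10 := by
    gcongr
  linarith

namespace IsKernel

variable {η : ℝ → ℝ} {ε : ℝ}

theorem integrable_transferKernel (hk : IsKernel η ε) (h1 : ε ≤ 1 / 10 ^ 3) {s A : ℝ} (hs : 0 < s)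
    (hs' : s ≤ 1.45) (hA : 0 ≤ A) : Integrable fun y => transferKernel s A y * η y :=
  hk.integrable_mul (measurable_transferKernel s A) _ fun _ hy =>
    abs_transferKernel_le hs hs' hA (hy.trans h1)

/-- Away from the cut-off, the weight differs from one only by `O(ε² A / t)`. -/
theorem abs_integral_transferKernel_sub_le (hk : IsKernel η ε) (h1 : ε ≤ 1 / 10 ^ 3) {s A : ℝ}
    (hs : 0 < s) (hs' : s ≤ 1.45) (hA : ∫ y, y ^ 2 * η y = 2 * A) :
    |(∫ y, transferKernel s A y * η y) - ∫ y, Real.exp (-y / 2) * η y| ≤ 16 * ε ^ 2 * A * s := by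
  have hA0 : 0 ≤ A := by have := hk.integral_second_nonneg; linarith
  have iK := hk.integrable_transferKernel h1 hs hs' hA0
  have iE : Integrable fun y => Real.exp (-y / 2) * η y := hk.integrable_of_continuous (by fun_prop)
  have i0 := hk.integrable
  have i1 : Integrable fun y => y * η y := hk.integrable_of_continuous (by fun_prop)
  have i2 : Integrable fun y => y ^ 2 * η y := hk.integrable_of_continuous (by fun_prop)
  have i3 : Integrable fun y => y ^ 3 * η y := hk.integrable_of_continuous (by fun_prop)
  have i4 : Integrable fun y => y ^ 4 * η y := hk.integrable_of_continuous (by fun_prop)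
  -- `P` is the Taylor polynomial of `transferKernel s A y - e^{-y/2} = s y e^{-y/2} / (1 - s y) + A
  -- s (...)`. Against `η` its odd terms vanish, and `s (s - 1/2) · 2A` cancels `A s (1 - 2s)`.
  set P : ℝ → ℝ := fun y => s * (y + (s - 1 / 2) * y ^ 2 + (s ^ 2 - s / 2 + 1 / 8) * y ^ 3) +
    A * s * (1 - 2 * s + (-1 / 2 + 3 * s - 6 * s ^ 2) * y) with hP
  have iP : Integrable fun y => P y * η y := hk.integrable_of_continuous (by fun_prop)
  have hPint : ∫ y, P y * η y = 0 := by
    have e : (fun y => P y * η y) = fun y => (A * s * (1 - 2 * s)) * η y +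
        (s + A * s * (-1 / 2 + 3 * s - 6 * s ^ 2)) * (y * η y) + (s * (s - 1 / 2)) * (y ^ 2 * η y) +
        (s * (s ^ 2 - s / 2 + 1 / 8)) * (y ^ 3 * η y) := by
      funext y; simp only [hP]; ring
    rw [e, integral_add (by fun_prop) (by fun_prop), integral_add (by fun_prop) (by fun_prop),
      integral_add (by fun_prop) (by fun_prop), integral_const_mul, integral_const_mul,
      integral_const_mul, integral_const_mul, hk.mass, hA,
      hk.integral_odd (g := fun y => y) (fun y => rfl),
      hk.integral_odd (g := fun y => y ^ 3) (fun y => by ring)]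
    ring
  have hdiff : ∫ y, (transferKernel s A y - Real.exp (-y / 2) - P y) * η y =
      (∫ y, transferKernel s A y * η y) - ∫ y, Real.exp (-y / 2) * η y := by
    have e : (fun y => (transferKernel s A y - Real.exp (-y / 2) - P y) * η y) = fun y =>
        transferKernel s A y * η y - Real.exp (-y / 2) * η y - P y * η y := by funext y; ring
    rw [e, integral_sub (by exact iK.sub iE) iP, integral_sub iK iE, hPint, sub_zero]
  rw [← hdiff]
  have hb0 : 0 < s ^ 2 - s / 2 + 1 / 8 := by nlinarith [sq_nonneg (s - 1 / 4)]
  have hb1 : s ^ 2 - s / 2 + 1 / 8 ≤ 1.51 := by nlinarith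
  have hsb : 1.01 * (1 / 30 + s * (s ^ 2 - s / 2 + 1 / 8)) ≤ 2.25 := by nlinarith
  have hbound := hk.abs_integral_le
    (g₁ := fun y => transferKernel s A y - Real.exp (-y / 2) - P y)
    (g₂ := fun y => s * (2.25 * y ^ 4) + A * s * (32 * y ^ 2))
    (by
      have := (iK.sub iE).sub iP
      refine this.congr (Filter.Eventually.of_forall fun y => ?_)
      simp only [Pi.sub_apply]; ring) (by fun_prop)
    (fun y => by positivity)
    (fun y hy => by
      have hy' := hy.trans h1
      have b1 := abs_exp_div_sub_le hs hs' hy'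
      have b2 := abs_exp_mul_sub_le hs hs' hy'
      have hD : (1 - s * y) ≠ 0 := by
        have : |s * y| ≤ 0.00145 := by
          rw [abs_mul, abs_of_pos hs]
          calc s * |y| ≤ 1.45 * (1 / 10 ^ 3) := by gcongr
            _ = _ := by norm_num
        linarith [(abs_le.1 this).2]
      have e : transferKernel s A y - Real.exp (-y / 2) - P y =
          s * (y * (Real.exp (-y / 2) / (1 - s * y) -
            (1 + (s - 1 / 2) * y + (s ^ 2 - s / 2 + 1 / 8) * y ^ 2))) +
          A * s * (Real.exp (-y / 2) * (1 - s * y - 2 * s) / (1 - s * y) ^ 3 -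
            (1 - 2 * s + (-1 / 2 + 3 * s - 6 * s ^ 2) * y)) := by
        -- This gives `e^{-y/2}/(1 - s y) - e^{-y/2} = s y e^{-y/2}/(1 - s y)`, whose factor `s y`
        -- raises the cubic remainder to fourth order and supplies the factor `s`.
        have e0 : Real.exp (-y / 2) = Real.exp (-y / 2) / (1 - s * y) * (1 - s * y) :=
          (div_mul_cancel₀ _ hD).symm
        simp only [hP, transferKernel]
        linear_combination -e0
      rw [e]
      refine (abs_add_le _ _).trans ?_
      rw [abs_mul s, abs_mul (A * s), abs_of_pos hs, abs_of_nonneg (by positivity : 0 ≤ A * s),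
        abs_mul y]
      have h4 : |y| * |y| ^ 3 = y ^ 4 := by
        calc |y| * |y| ^ 3 = (|y| ^ 2) ^ 2 := by ring
          _ = y ^ 4 := by rw [sq_abs]; ring
      have : |y| * |Real.exp (-y / 2) / (1 - s * y) -
          (1 + (s - 1 / 2) * y + (s ^ 2 - s / 2 + 1 / 8) * y ^ 2)| ≤ 2.25 * y ^ 4 := by
        calc _ ≤ |y| * (2.25 * |y| ^ 3) := by
              gcongr
              exact b1.trans (by gcongr)
          _ = 2.25 * y ^ 4 := by rw [← h4]; ring
      gcongr)
  refine hbound.trans ?_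
  have e : (fun y => (s * (2.25 * y ^ 4) + A * s * (32 * y ^ 2)) * η y) = fun y =>
      (s * 2.25) * (y ^ 4 * η y) + (A * s * 32) * (y ^ 2 * η y) := by funext y; ring
  rw [e, integral_add (by fun_prop) (by fun_prop), integral_const_mul, integral_const_mul, hA]
  have h4 := hk.integral_pow_four_le
  have h2 := hk.second
  rw [hA] at h4 h2
  have hsA : 0 ≤ s * A := by positivity
  have k1 : s * 2.25 * (∫ y, y ^ 4 * η y) ≤ s * 2.25 * (ε ^ 2 * (2 * A)) := by gcongr
  -- Only one of the two factors `A` is replaced, through `2A ≤ ε²/3`. The total is `(4.5 + 32/3) ε²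
  -- A s`, below `16 ε² A s`.
  have k2 : A * s * 32 * (2 * A) ≤ A * s * 32 * (ε ^ 2 / 3) := by gcongr
  have : 0 ≤ s * A * ε ^ 2 := by positivity
  nlinarith

theorem integral_Ici_zero_of_even (hk : IsKernel η ε) {g : ℝ → ℝ} (hg : ∀ y, g (-y) = g y)
    (hi : Integrable fun y => g y * η y) :
    ∫ y in Set.Ici 0, g y * η y = (∫ y, g y * η y) / 2 := by
  have h := hk.integral_comp_neg_Ici g 0
  simp only [hg, neg_zero] at h
  have h2 := intervalIntegral.integral_Iic_add_Ioi (b := (0 : ℝ)) hi.integrableOn hi.integrableOn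
  rw [← integral_Ici_eq_integral_Ioi] at h2
  linarith

theorem setIntegral_Ici_anti (hk : IsKernel η ε) {g : ℝ → ℝ} (hg : ∀ y, 0 ≤ g y)
    (hi : Integrable fun y => g y * η y) {u v : ℝ} (huv : u ≤ v) :
    ∫ y in Set.Ici v, g y * η y ≤ ∫ y in Set.Ici u, g y * η y :=
  setIntegral_mono_set hi.integrableOn
    (Filter.Eventually.of_forall fun y => mul_nonneg (hg y) (hk.nonneg y))
    (Set.Ici_subset_Ici.2 huv).eventuallyLE

theorem integral_Iic_add_Ici {g : ℝ → ℝ} (hi : Integrable g) (u : ℝ) :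
    (∫ y in Set.Iic u, g y) + ∫ y in Set.Ici u, g y = ∫ y, g y := by
  rw [integral_Ici_eq_integral_Ioi]
  exact intervalIntegral.integral_Iic_add_Ioi hi.integrableOn hi.integrableOn

/-! ### The transfer kernel cut off near `x` -/

/-- The second-order part of `transferKernel` which is not accounted for by `bigM`. -/
noncomputable def quadPart (s A y : ℝ) : ℝ :=
  (s ^ 2 - s / 2 + 1 / 8) * y ^ 2 + A * s * (1 - 2 * s)

theorem quadPart_nonneg {s A : ℝ} (hs : 0 < s) (hs' : s ≤ 0.11) (hA : 0 ≤ A) (y : ℝ) :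
    0 ≤ quadPart s A y := by
  have hb0 : 0 < s ^ 2 - s / 2 + 1 / 8 := by nlinarith [sq_nonneg (s - 1 / 4)]
  have : 0 ≤ 1 - 2 * s := by linarith
  unfold quadPart
  positivity

/-- The terms depending on `s` cancel, because the second moment is `2A`. The value `A/4` is the
main term of `λ - 1`, which is what makes the error near `x` a mere tail. -/
theorem integral_quadPart (hk : IsKernel η ε) {s A : ℝ} (hA : ∫ y, y ^ 2 * η y = 2 * A) :
    ∫ y, quadPart s A y * η y = A / 4 := by
  have i0 := hk.integrable
  have i2 : Integrable fun y => y ^ 2 * η y := hk.integrable_of_continuous (by fun_prop)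
  have e : (fun y => quadPart s A y * η y) = fun y =>
      (s ^ 2 - s / 2 + 1 / 8) * (y ^ 2 * η y) + (A * s * (1 - 2 * s)) * η y := by
    funext y; simp only [quadPart]; ring
  rw [e, integral_add (by fun_prop) (by fun_prop), integral_const_mul, integral_const_mul, hk.mass,
    hA]
  ring

theorem integrable_quadPart (hk : IsKernel η ε) (s A : ℝ) :
    Integrable fun y => quadPart s A y * η y :=
  hk.integrable_of_continuous (by unfold quadPart; fun_prop)

/-- The integrand is even and nonnegative, so a tail starting at `u ≥ 0` is at most half of the
total `A/4`. -/
theorem integral_Ici_quadPart_mem (hk : IsKernel η ε) {s A : ℝ} (hs : 0 < s) (hs' : s ≤ 0.11)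
    (hA : ∫ y, y ^ 2 * η y = 2 * A) {u : ℝ} (hu : 0 ≤ u) :
    0 ≤ ∫ y in Set.Ici u, quadPart s A y * η y ∧
      ∫ y in Set.Ici u, quadPart s A y * η y ≤ A / 8 := by
  have hA0 : 0 ≤ A := by have := hk.integral_second_nonneg; linarith
  have hnn := quadPart_nonneg hs hs' hA0
  refine ⟨setIntegral_nonneg measurableSet_Ici fun y _ => mul_nonneg (hnn y) (hk.nonneg y), ?_⟩
  refine (hk.setIntegral_Ici_anti hnn (hk.integrable_quadPart s A) hu).trans ?_
  rw [hk.integral_Ici_zero_of_even (fun y => by simp only [quadPart]; ring)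
    (hk.integrable_quadPart s A), hk.integral_quadPart hA]
  linarith

/-- Second-order expansion of the truncated integral of `transferKernel`. -/
theorem abs_integral_Ici_transferKernel_sub_le (hk : IsKernel η ε) (h0 : 0 ≤ ε)
    (h1 : ε ≤ 1 / 10 ^ 3) {s A : ℝ} (hs : 0 < s) (hs' : s ≤ 0.11)
    (hA : ∫ y, y ^ 2 * η y = 2 * A) (u : ℝ) :
    |(∫ y in Set.Ici u, transferKernel s A y * η y) - ((∫ y in Set.Ici u, η y) +
      (s - 1 / 2) * (∫ y in Set.Ici u, y * η y) + ∫ y in Set.Ici u, quadPart s A y * η y)| ≤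
      A / 2000 := by
  have hA0 : 0 ≤ A := by have := hk.integral_second_nonneg; linarith
  have hs2 : s ≤ 1.45 := hs'.trans (by norm_num)
  have iK := hk.integrable_transferKernel h1 hs hs2 hA0
  have i0 := hk.integrable
  have i1 : Integrable fun y => y * η y := hk.integrable_of_continuous (by fun_prop)
  have i2 : Integrable fun y => y ^ 2 * η y := hk.integrable_of_continuous (by fun_prop)
  have iQ := hk.integrable_quadPart s A
  have e : (∫ y in Set.Ici u, transferKernel s A y * η y) - ((∫ y in Set.Ici u, η y) +
      (s - 1 / 2) * (∫ y in Set.Ici u, y * η y) + ∫ y in Set.Ici u, quadPart s A y * η y) =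
      ∫ y in Set.Ici u, (transferKernel s A y - (1 + (s - 1 / 2) * y + quadPart s A y)) * η y := by
    have e1 : (fun y => (transferKernel s A y - (1 + (s - 1 / 2) * y + quadPart s A y)) * η y) =
        fun y => transferKernel s A y * η y - (η y + (s - 1 / 2) * (y * η y) +
          quadPart s A y * η y) := by funext y; ring
    rw [e1, integral_sub iK.integrableOn (by
        exact ((i0.add (i1.const_mul _)).add iQ).integrableOn),
      integral_add (by exact (i0.add (i1.const_mul _)).integrableOn) iQ.integrableOn,
      integral_add i0.integrableOn (by exact (i1.const_mul _).integrableOn), integral_const_mul]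
  rw [e]
  have hb0 : 0 < s ^ 2 - s / 2 + 1 / 8 := by nlinarith [sq_nonneg (s - 1 / 4)]
  have hb1 : s ^ 2 - s / 2 + 1 / 8 ≤ 1 / 8 := by nlinarith
  have hsb : 1.01 * (1 / 30 + s * (s ^ 2 - s / 2 + 1 / 8)) ≤ 0.05 := by nlinarith
  have hβ : |(-1 / 2 + 3 * s - 6 * s ^ 2)| ≤ 0.5 := by rw [abs_le]; constructor <;> nlinarith
  have hbound := hk.abs_setIntegral_le
    (g₁ := fun y => transferKernel s A y - (1 + (s - 1 / 2) * y + quadPart s A y))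
    (g₂ := fun y => ε * (0.05 * y ^ 2 + 0.06 * A)) (Set.Ici u) measurableSet_Ici
    (by
      have := iK.sub ((i0.add (i1.const_mul (s - 1 / 2))).add iQ)
      refine this.congr (Filter.Eventually.of_forall fun y => ?_)
      simp only [Pi.sub_apply, Pi.add_apply]; ring) (by fun_prop)
    (fun y => by positivity)
    (fun y hy => by
      have hy' := hy.trans h1
      have b1 := abs_exp_div_sub_le hs hs2 hy'
      have b2 := abs_exp_mul_sub_le hs hs2 hy'
      have e : transferKernel s A y - (1 + (s - 1 / 2) * y + quadPart s A y) =
          (Real.exp (-y / 2) / (1 - s * y) -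
            (1 + (s - 1 / 2) * y + (s ^ 2 - s / 2 + 1 / 8) * y ^ 2)) +
          A * s * ((Real.exp (-y / 2) * (1 - s * y - 2 * s) / (1 - s * y) ^ 3 -
            (1 - 2 * s + (-1 / 2 + 3 * s - 6 * s ^ 2) * y)) +
            (-1 / 2 + 3 * s - 6 * s ^ 2) * y) := by
        simp only [quadPart, transferKernel]
        ring
      rw [e]
      refine (abs_add_le _ _).trans ?_
      rw [abs_mul (A * s), abs_of_nonneg (by positivity : 0 ≤ A * s)]
      have c1 : |Real.exp (-y / 2) / (1 - s * y) -
            (1 + (s - 1 / 2) * y + (s ^ 2 - s / 2 + 1 / 8) * y ^ 2)| ≤ ε * (0.05 * y ^ 2) := by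
        have e3 : |y| ^ 3 = |y| * y ^ 2 := by rw [pow_succ', sq_abs]
        calc _ ≤ 0.05 * |y| ^ 3 := b1.trans (by gcongr)
          _ = |y| * (0.05 * y ^ 2) := by rw [e3]; ring
          _ ≤ _ := by gcongr
      have c2 : |(Real.exp (-y / 2) * (1 - s * y - 2 * s) / (1 - s * y) ^ 3 -
            (1 - 2 * s + (-1 / 2 + 3 * s - 6 * s ^ 2) * y)) +
            (-1 / 2 + 3 * s - 6 * s ^ 2) * y| ≤ 0.54 * ε := by
        have e2 : y ^ 2 = |y| * |y| := by rw [← sq, sq_abs]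
        have e4 : y ^ 2 ≤ ε * (1 / 10 ^ 3) := by
          rw [e2]; gcongr
        calc _ ≤ 32 * y ^ 2 + 0.5 * ε := by
              refine (abs_add_le _ _).trans ?_
              rw [abs_mul]
              gcongr
          _ ≤ _ := by norm_num at e4; linarith
      have c3 : A * s * |(Real.exp (-y / 2) * (1 - s * y - 2 * s) / (1 - s * y) ^ 3 -
            (1 - 2 * s + (-1 / 2 + 3 * s - 6 * s ^ 2) * y)) +
            (-1 / 2 + 3 * s - 6 * s ^ 2) * y| ≤ A * 0.11 * (0.54 * ε) := by gcongr
      have : 0 ≤ A * ε := by positivity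
      linarith)
  refine hbound.trans ?_
  have e : (fun y => (ε * (0.05 * y ^ 2 + 0.06 * A)) * η y) = fun y =>
      (ε * 0.05) * (y ^ 2 * η y) + (ε * 0.06 * A) * η y := by funext y; ring
  rw [e, integral_add (by fun_prop) (by fun_prop), integral_const_mul, integral_const_mul, hA,
    hk.mass]
  norm_num at h1
  nlinarith

end IsKernel

/-! ### Half-line integrals of the kernel: `μ` and `ν` -/

namespace IsKernel

variable {η : ℝ → ℝ} {ε : ℝ}

theorem integral_Iic_eq_zero (hk : IsKernel η ε) {τ : ℝ} (hτ : τ < -ε) :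
    ∫ y in Set.Iic τ, η y = 0 := by
  refine setIntegral_eq_zero_of_forall_eq_zero fun y hy => hk.supp y ?_
  rw [Set.mem_Iic] at hy
  exact lt_abs.2 (Or.inr (by linarith))

theorem monotone_integral_Iic (hk : IsKernel η ε) : Monotone fun τ => ∫ y in Set.Iic τ, η y :=
  fun _ _ h => setIntegral_mono_set hk.integrable.integrableOn
    (Filter.Eventually.of_forall hk.nonneg) (Set.Iic_subset_Iic.2 h).eventuallyLE

theorem integral_Iic_nonneg (hk : IsKernel η ε) (τ : ℝ) : 0 ≤ ∫ y in Set.Iic τ, η y :=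
  integral_nonneg fun y => hk.nonneg y

theorem integral_Iic_le_one (hk : IsKernel η ε) (τ : ℝ) : ∫ y in Set.Iic τ, η y ≤ 1 := by
  rw [← hk.mass]
  exact setIntegral_le_integral hk.integrable (Filter.Eventually.of_forall hk.nonneg)

/-- The iterated integral of a kernel. -/
theorem integral_Iic_integral_Iic (hk : IsKernel η ε) (u : ℝ) :
    ∫ τ in Set.Iic u, ∫ y in Set.Iic τ, η y = ∫ y in Set.Iic u, (u - y) * η y := by
  -- Cutting the outer integral down to `[-ε, u]` makes its measure finite, so that Fubini applies
  -- to an integrand depending on `y` alone, restricted to `y ≤ τ`.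
  have h1 : ∫ τ in Set.Iic u, ∫ y in Set.Iic τ, η y =
      ∫ τ in Set.Icc (-ε) u, ∫ y in Set.Iic τ, η y := by
    refine setIntegral_eq_of_subset_of_forall_sdiff_eq_zero measurableSet_Iic
      Set.Icc_subset_Iic_self fun τ hτ => hk.integral_Iic_eq_zero ?_
    by_contra h
    exact hτ.2 ⟨not_lt.1 h, hτ.1⟩
  have h2 : ∀ τ, ∫ y in Set.Iic τ, η y =
      ∫ y, {p : ℝ × ℝ | p.2 ≤ p.1}.indicator (fun p => η p.2) (τ, y) := by
    intro τ
    rw [← integral_indicator measurableSet_Iic]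
    rfl
  rw [h1]
  simp_rw [h2]
  -- For `y` in the support the inner integral is now `η y` times the length of `[y, u]`.
  rw [integral_integral_swap]
  · rw [← integral_indicator measurableSet_Iic]
    refine integral_congr_ae (Filter.Eventually.of_forall fun y => ?_)
    have e1 : (fun τ => {p : ℝ × ℝ | p.2 ≤ p.1}.indicator (fun p => η p.2) (τ, y)) =
        (Set.Ici y).indicator fun _ => η y := rfl
    simp only [e1]
    rw [integral_indicator measurableSet_Ici, Measure.restrict_restrict measurableSet_Ici,
      setIntegral_const]
    by_cases hy : |y| ≤ ε
    · have hset : Set.Ici y ∩ Set.Icc (-ε) u = Set.Icc y u := by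
        ext τ
        simp only [Set.mem_inter_iff, Set.mem_Ici, Set.mem_Icc]
        have := (abs_le.1 hy).1
        constructor
        · rintro ⟨a, -, b⟩; exact ⟨a, b⟩
        · rintro ⟨a, b⟩; exact ⟨a, this.trans a, b⟩
      rw [hset, Real.volume_real_Icc, smul_eq_mul]
      by_cases hyu : y ≤ u
      · rw [Set.indicator_of_mem (Set.mem_Iic.2 hyu), max_eq_left (by linarith)]
      · rw [Set.indicator_of_notMem (by simpa using hyu), max_eq_right (by linarith)]
        simp
    · rw [hk.supp y (not_le.1 hy), smul_zero]
      by_cases hyu : y ≤ u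
      · rw [Set.indicator_of_mem (Set.mem_Iic.2 hyu), hk.supp y (not_le.1 hy), mul_zero]
      · rw [Set.indicator_of_notMem (by simpa using hyu)]
  · have : Integrable (fun p : ℝ × ℝ => η p.2) ((volume.restrict (Set.Icc (-ε) u)).prod volume) :=
      hk.integrable.comp_snd _
    exact this.indicator (measurableSet_le measurable_snd measurable_fst)

end IsKernel

section MuNu

variable {c ε : ℝ}

theorem mu_of_neg {u : ℝ} (hu : u < 0) : mu c ε u = -∫ y in Set.Iic u, eta c ε y := by
  rw [mu, if_pos hu]

theorem mu_of_pos (hk : IsKernel (eta c ε) ε) {u : ℝ} (hu : 0 < u) :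
    mu c ε u = ∫ y in Set.Ici u, eta c ε y := by
  rw [mu, if_neg (not_lt.2 hu.le), if_pos hu]
  have := hk.integral_comp_neg_Ici (fun _ => 1) u
  simpa using this.symm

theorem mu_zero : mu c ε 0 = 0 := by simp [mu]

theorem mu_neg (u : ℝ) : mu c ε (-u) = -mu c ε u := by
  rcases lt_trichotomy u 0 with h | rfl | h
  · rw [mu, mu, if_pos h, if_neg (by linarith), if_pos (by linarith), neg_neg, neg_neg]
  · simp [mu_zero]
  · rw [mu, mu, if_pos (by linarith), if_neg (by linarith), if_pos h]

theorem measurable_mu (hk : IsKernel (eta c ε) ε) : Measurable (mu c ε) := by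
  have h := hk.monotone_integral_Iic.measurable
  refine Measurable.ite measurableSet_Iio h.neg ?_
  exact Measurable.ite measurableSet_Ioi (h.comp measurable_neg) measurable_const

theorem abs_mu_le_one (hk : IsKernel (eta c ε) ε) (u : ℝ) : |mu c ε u| ≤ 1 := by
  unfold mu
  split_ifs
  · rw [abs_neg, abs_of_nonneg (hk.integral_Iic_nonneg u)]; exact hk.integral_Iic_le_one u
  · rw [abs_of_nonneg (hk.integral_Iic_nonneg _)]; exact hk.integral_Iic_le_one _
  · simp

theorem integrableOn_mu (hk : IsKernel (eta c ε) ε) (h0 : 0 < ε) (u : ℝ) :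
    IntegrableOn (mu c ε) (Set.Iic u) := by
  have h1 : IntegrableOn (mu c ε) (Set.Icc (-ε) u) :=
    Measure.integrableOn_of_bounded (M := 1) (by simp) (measurable_mu hk).aestronglyMeasurable
      (Filter.Eventually.of_forall fun τ => abs_mu_le_one hk τ)
  have h2 : IntegrableOn (mu c ε) (Set.Iio (-ε)) := by
    refine (integrableOn_zero (s := Set.Iio (-ε))).congr_fun (fun τ hτ => ?_) measurableSet_Iio
    rw [Set.mem_Iio] at hτ
    rw [mu_of_neg (by linarith), hk.integral_Iic_eq_zero hτ, neg_zero]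
  refine (h2.union h1).mono_set fun τ hτ => ?_
  rcases lt_or_ge τ (-ε) with h | h
  · exact Or.inl h
  · exact Or.inr ⟨h, hτ⟩

/-- The difference of the two values is, up to sign, the integral of the odd function `μ` over a
symmetric interval. -/
theorem nu_neg (hk : IsKernel (eta c ε) ε) (h0 : 0 < ε) (u : ℝ) :
    nu c ε (-u) = nu c ε u := by
  have h1 := intervalIntegral.integral_Iic_sub_Iic (integrableOn_mu hk h0 (-u))
    (integrableOn_mu hk h0 u)
  have h2 := intervalIntegral.integral_comp_neg (a := -u) (b := u) (mu c ε)
  simp only [mu_neg, neg_neg, intervalIntegral.integral_neg] at h2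
  simp only [nu]
  linarith

/-- The first moment over a half line in terms of `μ` and `ν`. -/
theorem mu_mul_sub_nu (hk : IsKernel (eta c ε) ε) (h0 : 0 < ε) (u : ℝ) :
    mu c ε u * u - nu c ε u = ∫ y in Set.Ici u, y * eta c ε y := by
  have i1 : Integrable fun y => y * eta c ε y := hk.integrable_of_continuous (by fun_prop)
  have hodd := hk.integral_odd (g := fun y => y) (fun y => rfl)
  -- For `u ≤ 0` the left side is `-u ∫_{y ≤ u} η + ∫_{y ≤ u} (u - y) η = -∫_{y ≤ u} y η`, which is
  -- the complementary first moment since the full one vanishes. Positive `u` follow by parity.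
  have hneg : ∀ u ≤ 0, mu c ε u * u - nu c ε u = ∫ y in Set.Ici u, y * eta c ε y := by
    intro u hu
    have h1 : nu c ε u = -∫ τ in Set.Iic u, ∫ y in Set.Iic τ, eta c ε y := by
      -- The endpoint is dropped because for `u = 0` the formula for negative arguments need not
      -- hold at `τ = 0`, where `μ` is set to 0.
      rw [nu, ← integral_neg, integral_Iic_eq_integral_Iio, integral_Iic_eq_integral_Iio]
      refine setIntegral_congr_fun measurableSet_Iio fun τ hτ => ?_
      exact mu_of_neg (lt_of_lt_of_le hτ hu)
    have h2 : mu c ε u * u = -(u * ∫ y in Set.Iic u, eta c ε y) := by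
      rcases hu.lt_or_eq with h | h
      · rw [mu_of_neg h]; ring
      · rw [h]; simp
    have h3 : ∫ y in Set.Iic u, (u - y) * eta c ε y =
        u * (∫ y in Set.Iic u, eta c ε y) - ∫ y in Set.Iic u, y * eta c ε y := by
      rw [← integral_const_mul, ← integral_sub (hk.integrable.const_mul u).integrableOn
        i1.integrableOn]
      simp only [sub_mul]
    have h4 := IsKernel.integral_Iic_add_Ici i1 u
    rw [h1, h2, hk.integral_Iic_integral_Iic, h3]
    linarith
  rcases le_total u 0 with h | h
  · exact hneg u h
  · have h1 := hneg (-u) (by linarith)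
    rw [mu_neg, nu_neg hk h0] at h1
    have h2 := hk.integral_comp_neg_Ici (fun y => y) (-u)
    simp only [neg_neg, neg_mul, integral_neg] at h2
    have h3 := IsKernel.integral_Iic_add_Ici i1 u
    linarith

end MuNu

/-! ### The kernel `η_{c,ε}` -/

theorem hasSum_besselI0 (y : ℝ) :
    HasSum (fun n : ℕ => (y / 2) ^ (2 * n) / ((n.factorial : ℝ) ^ 2)) (besselI0 y) := by
  refine Summable.hasSum ?_
  refine Summable.of_nonneg_of_le (fun n => ?_) (fun n => ?_)
    (Real.summable_pow_div_factorial ((y / 2) ^ 2))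
  · rw [pow_mul]; positivity
  · rw [pow_mul]
    have : (1 : ℝ) ≤ n.factorial := by exact_mod_cast n.factorial_pos
    gcongr
    nlinarith

theorem besselI0_nonneg (y : ℝ) : 0 ≤ besselI0 y :=
  (hasSum_besselI0 y).nonneg fun n => by rw [pow_mul]; positivity

theorem measurable_besselI0 : Measurable besselI0 := by
  refine measurable_of_tendsto_metrizable (f := fun N y => ∑ n ∈ Finset.range N,
    (y / 2) ^ (2 * n) / ((n.factorial : ℝ) ^ 2)) (fun N => by fun_prop) ?_
  exact tendsto_pi_nhds.2 fun y => (hasSum_besselI0 y).tendsto_sum_nat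

theorem besselI0_le {y z : ℝ} (h : |y| ≤ |z|) : besselI0 y ≤ besselI0 z := by
  refine hasSum_le (fun n => ?_) (hasSum_besselI0 y) (hasSum_besselI0 z)
  have h1 := sq_le_sq.2 h
  have h2 : (y / 2) ^ 2 ≤ (z / 2) ^ 2 := by
    rw [div_pow, div_pow]
    gcongr
  rw [pow_mul, pow_mul]
  gcongr

theorem chiStar_Icc_of_mem {y : ℝ} (hy : y ∈ Set.Ioo (-1 : ℝ) 1) :
    chiStar (Set.Icc (-1) 1) y = 1 := by
  have h : y ∉ ({-1, 1} : Set ℝ) := by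
    simp only [Set.mem_insert_iff, Set.mem_singleton_iff, not_or]
    exact ⟨hy.1.ne', hy.2.ne⟩
  simp [chiStar, interior_Icc, frontier_Icc (show (-1 : ℝ) ≤ 1 by norm_num), hy, h]

theorem chiStar_Icc_of_lt_abs {y : ℝ} (hy : 1 < |y|) : chiStar (Set.Icc (-1) 1) y = 0 := by
  have h1 : y ∉ Set.Ioo (-1 : ℝ) 1 := fun h => by
    have := abs_lt.2 h; linarith
  have h : y ∉ ({-1, 1} : Set ℝ) := by
    rintro (h | h) <;> rw [h] at hy <;> norm_num at hy
  rw [chiStar, interior_Icc, frontier_Icc (show (-1 : ℝ) ≤ 1 by norm_num),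
    Set.indicator_of_notMem h1, Set.indicator_of_notMem h, add_zero]

/-- The bound 2 is crude: it serves only to show that `η_c` is bounded. -/
theorem chiStar_mem_Icc (A : Set ℝ) (y : ℝ) : 0 ≤ chiStar A y ∧ chiStar A y ≤ 2 := by
  unfold chiStar
  simp only [Set.indicator]
  split_ifs <;> norm_num

theorem chiStar_Icc_neg (y : ℝ) :
    chiStar (Set.Icc (-1) 1) (-y) = chiStar (Set.Icc (-1) 1) y := by
  have h1 : -y ∈ Set.Ioo (-1 : ℝ) 1 ↔ y ∈ Set.Ioo (-1 : ℝ) 1 := by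
    simp only [Set.mem_Ioo]; constructor <;> rintro ⟨a, b⟩ <;> constructor <;> linarith
  have h2 : -y ∈ ({-1, 1} : Set ℝ) ↔ y ∈ ({-1, 1} : Set ℝ) := by
    simp only [Set.mem_insert_iff, Set.mem_singleton_iff, neg_eq_iff_eq_neg, neg_neg]; tauto
  rw [chiStar, chiStar, interior_Icc, frontier_Icc (show (-1 : ℝ) ≤ 1 by norm_num)]
  simp only [Set.indicator, h1, h2]

theorem measurable_chiStar (A : Set ℝ) : Measurable (chiStar A) :=
  (measurable_const.indicator isOpen_interior.measurableSet).add
    (measurable_const.indicator isClosed_frontier.measurableSet)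

theorem measurable_eta1 (c : ℝ) : Measurable (eta1 c) := by
  have := measurable_chiStar (Set.Icc (-1) 1)
  have := measurable_besselI0
  unfold eta1
  fun_prop

theorem eta1_neg (c y : ℝ) : eta1 c (-y) = eta1 c y := by
  simp only [eta1, chiStar_Icc_neg, neg_sq]

theorem eta1_of_lt_abs (c : ℝ) {y : ℝ} (hy : 1 < |y|) : eta1 c y = 0 := by
  simp [eta1, chiStar_Icc_of_lt_abs hy]

theorem eta1_nonneg {c : ℝ} (hc : 0 < c) (y : ℝ) : 0 ≤ eta1 c y := by
  have := Real.sinh_pos_iff.2 hc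
  have h1 := (chiStar_mem_Icc (Set.Icc (-1) 1) y).1
  have h2 := besselI0_nonneg (c * √(1 - y ^ 2))
  unfold eta1
  positivity

theorem eta1_le {c : ℝ} (hc : 0 < c) (y : ℝ) :
    eta1 c y ≤ 2 * (c / (2 * Real.sinh c)) * besselI0 c := by
  have := Real.sinh_pos_iff.2 hc
  have h1 := (chiStar_mem_Icc (Set.Icc (-1) 1) y)
  have h2 := besselI0_nonneg (c * √(1 - y ^ 2))
  have h3 : besselI0 (c * √(1 - y ^ 2)) ≤ besselI0 c := by
    apply besselI0_le
    rw [abs_mul, abs_of_nonneg (Real.sqrt_nonneg _)]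
    have : √(1 - y ^ 2) ≤ 1 := Real.sqrt_le_one.2 (by nlinarith [sq_nonneg y])
    exact mul_le_of_le_one_right (abs_nonneg _) this
  unfold eta1
  gcongr
  exact h1.2

theorem integrable_mul_eta1 {c : ℝ} (hc : 0 < c) {g : ℝ → ℝ} (hg : Continuous g) :
    Integrable fun y => g y * eta1 c y := by
  obtain ⟨C, hC⟩ :=
    (isCompact_Icc (a := (-1 : ℝ)) (b := 1)).exists_bound_of_continuousOn hg.continuousOn
  have h1 : IntegrableOn (fun y => g y * eta1 c y) (Set.Icc (-1) 1) := by
    refine Measure.integrableOn_of_bounded (M := C * (2 * (c / (2 * Real.sinh c)) * besselI0 c))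
      (by simp) (hg.measurable.mul (measurable_eta1 c)).aestronglyMeasurable ?_
    refine (ae_restrict_iff' measurableSet_Icc).2 (Filter.Eventually.of_forall fun y hy => ?_)
    rw [norm_mul]
    have h0 := hC y hy
    rw [Real.norm_of_nonneg (eta1_nonneg hc y)]
    exact mul_le_mul h0 (eta1_le hc y) (eta1_nonneg hc y) ((norm_nonneg _).trans h0)
  refine (integrableOn_iff_integrable_of_support_subset fun y hy => ?_).1 h1
  by_contra h
  have : 1 < |y| := by
    by_contra h'
    exact h (abs_le.1 (not_lt.1 h'))
  exact hy (by simp [eta1_of_lt_abs c this])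

/-- The integral of `(1 - y ^ 2) ^ n` over `[-1, 1]`. -/
noncomputable def wallis (n : ℕ) : ℝ := ∫ y in (-1 : ℝ)..1, (1 - y ^ 2) ^ n

/-- Integrate the derivative of `y (1 - y²)^(n+1)`, which vanishes at both endpoints. -/
theorem wallis_succ (n : ℕ) : wallis (n + 1) * (2 * n + 3) = (2 * n + 2) * wallis n := by
  have hd : ∀ y ∈ Set.uIcc (-1 : ℝ) 1, HasDerivAt (fun y : ℝ => y * (1 - y ^ 2) ^ (n + 1))
      ((2 * n + 3) * (1 - y ^ 2) ^ (n + 1) - (2 * n + 2) * (1 - y ^ 2) ^ n) y := by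
    intro y _
    have h1 : HasDerivAt (fun y : ℝ => 1 - y ^ 2) (-(2 * y)) y := by
      simpa using (hasDerivAt_pow 2 y).const_sub 1
    have h2 := (hasDerivAt_id y).mul (h1.pow (n + 1))
    refine h2.congr_deriv ?_
    simp only [id, Nat.add_sub_cancel, Pi.pow_apply]
    push_cast
    ring
  have h := intervalIntegral.integral_eq_sub_of_hasDerivAt hd
    (Continuous.intervalIntegrable (by fun_prop) _ _)
  rw [intervalIntegral.integral_sub (Continuous.intervalIntegrable (by fun_prop) _ _)
    (Continuous.intervalIntegrable (by fun_prop) _ _), intervalIntegral.integral_const_mul,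
    intervalIntegral.integral_const_mul] at h
  norm_num at h
  simp only [wallis]
  linarith

theorem integral_sq_mul_one_sub_sq_pow (n : ℕ) :
    ∫ y in (-1 : ℝ)..1, y ^ 2 * (1 - y ^ 2) ^ n = wallis n / (2 * n + 3) := by
  have h : ∫ y in (-1 : ℝ)..1, y ^ 2 * (1 - y ^ 2) ^ n = wallis n - wallis (n + 1) := by
    rw [wallis, wallis, ← intervalIntegral.integral_sub
      (Continuous.intervalIntegrable (by fun_prop) _ _)
      (Continuous.intervalIntegrable (by fun_prop) _ _)]
    congr 1
    funext y
    ring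
  have := wallis_succ n
  have h3 : (2 * n + 3 : ℝ) ≠ 0 := by positivity
  rw [h, eq_div_iff h3]
  linarith

/-- Integrating the series of `I₀(c √(1 - y²))` term by term thus yields twice the series of `sinh c
/ c`, which explains the normalization of `η_c`. -/
theorem coeff_mul_wallis (c : ℝ) (n : ℕ) :
    (c ^ 2 / 4) ^ n / ((n.factorial : ℝ) ^ 2) * wallis n =
      2 * (c ^ (2 * n) / ((2 * n + 1).factorial : ℝ)) := by
  induction n with
  | zero => norm_num [wallis]
  | succ n ih =>
    have h := wallis_succ n
    have h3 : (2 * n + 3 : ℝ) ≠ 0 := by positivity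
    have hw : wallis (n + 1) = (2 * n + 2) * wallis n / (2 * n + 3) := by
      rw [eq_div_iff h3]; exact h
    have e : (2 * (n + 1) + 1).factorial = (2 * n + 3) * ((2 * n + 2) * (2 * n + 1).factorial) := by
      rw [show 2 * (n + 1) + 1 = (2 * n + 1) + 1 + 1 by ring, Nat.factorial_succ, Nat.factorial_succ]
    have hf : ((2 * n + 1).factorial : ℝ) ≠ 0 := by positivity
    have hf2 : (n.factorial : ℝ) ≠ 0 := by positivity
    calc _ = ((c ^ 2 / 4) ^ n / ((n.factorial : ℝ) ^ 2) * wallis n) *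
          (c ^ 2 / ((2 * n + 2) * (2 * n + 3))) := by
          rw [hw, Nat.factorial_succ]; push_cast; field_simp; ring
      _ = _ := by
          rw [ih, e]; push_cast; field_simp; ring

/-- Moments of `η_c`, computed term by term from the series of `I₀`. -/
theorem hasSum_integral_mul_eta1 {c : ℝ} (hc : 0 < c) {g : ℝ → ℝ} (hg : Continuous g)
    (hg0 : ∀ y, 0 ≤ g y) (hg1 : ∀ y, |y| ≤ 1 → g y ≤ 1) :
    HasSum (fun n : ℕ => c / (2 * Real.sinh c) * ((c ^ 2 / 4) ^ n / ((n.factorial : ℝ) ^ 2) *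
      ∫ y in (-1 : ℝ)..1, g y * (1 - y ^ 2) ^ n)) (∫ y, g y * eta1 c y) := by
  set F : ℕ → ℝ → ℝ := fun n y =>
    (c ^ 2 / 4) ^ n / ((n.factorial : ℝ) ^ 2) * (g y * (1 - y ^ 2) ^ n) with hF
  have hint : ∀ n, IntegrableOn (F n) (Set.Ioc (-1) 1) := fun n =>
    (Continuous.integrableOn_Icc (by fun_prop)).mono_set Set.Ioc_subset_Icc_self
  have hnn : ∀ n, ∀ y ∈ Set.Ioc (-1 : ℝ) 1, 0 ≤ F n y := by
    intro n y hy
    have : 0 ≤ 1 - y ^ 2 := by nlinarith [hy.1, hy.2]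
    have := hg0 y
    simp only [hF]
    positivity
  have hFint : ∀ n, ∫ y in Set.Ioc (-1) 1, F n y = (c ^ 2 / 4) ^ n / ((n.factorial : ℝ) ^ 2) *
      ∫ y in (-1 : ℝ)..1, g y * (1 - y ^ 2) ^ n := by
    intro n
    rw [intervalIntegral.integral_of_le (by norm_num), ← integral_const_mul]
  -- As `g ≤ 1` on `[-1, 1]`, the terms are dominated by those for `g = 1`, which `coeff_mul_wallis`
  -- compares with the series of `cosh c`.
  have hsum : Summable fun n => ∫ y in Set.Ioc (-1) 1, ‖F n y‖ := by
    have hs : Summable fun n : ℕ => 2 * (c ^ (2 * n) / ((2 * n + 1).factorial : ℝ)) := by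
      refine ((Real.hasSum_cosh c).summable.of_nonneg_of_le (fun n => by positivity)
        (fun n => ?_)).mul_left 2
      gcongr
      omega
    refine hs.of_nonneg_of_le (fun n => integral_nonneg fun y => norm_nonneg _) fun n => ?_
    rw [← coeff_mul_wallis, wallis, intervalIntegral.integral_of_le (by norm_num),
      ← integral_const_mul]
    refine setIntegral_mono_on (hint n).norm ((Continuous.integrableOn_Icc (by fun_prop)).mono_set
      Set.Ioc_subset_Icc_self) measurableSet_Ioc fun y hy => ?_
    rw [Real.norm_of_nonneg (hnn n y hy)]
    have h1 : 0 ≤ 1 - y ^ 2 := by nlinarith [hy.1, hy.2]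
    have h2 := hg1 y (abs_le.2 ⟨hy.1.le, hy.2⟩)
    simp only [hF]
    gcongr
    exact mul_le_of_le_one_left (by positivity) h2
  have key := (hasSum_integral_of_summable_integral_norm hint hsum).mul_left
    (c / (2 * Real.sinh c))
  simp only [hFint] at key
  suffices hval : ∫ y, g y * eta1 c y =
      c / (2 * Real.sinh c) * ∫ y in Set.Ioc (-1) 1, ∑' n, F n y by rwa [hval]
  have hsupp : ∫ y, g y * eta1 c y = ∫ y in Set.Icc (-1) 1, g y * eta1 c y := by
    symm
    refine setIntegral_eq_integral_of_forall_compl_eq_zero fun y hy => ?_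
    rw [eta1_of_lt_abs c, mul_zero]
    by_contra h'
    exact hy (abs_le.1 (not_lt.1 h'))
  rw [hsupp, integral_Icc_eq_integral_Ioo, integral_Ioc_eq_integral_Ioo, ← integral_const_mul]
  refine setIntegral_congr_fun measurableSet_Ioo fun y hy => ?_
  have h1 : 0 ≤ 1 - y ^ 2 := by nlinarith [hy.1, hy.2]
  have h2 : besselI0 (c * √(1 - y ^ 2)) =
      ∑' n : ℕ, (c ^ 2 / 4) ^ n / ((n.factorial : ℝ) ^ 2) * (1 - y ^ 2) ^ n := by
    rw [besselI0]
    congr 1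
    funext n
    rw [pow_mul, div_pow, mul_pow, Real.sq_sqrt h1, show c ^ 2 * (1 - y ^ 2) / 2 ^ 2 =
      c ^ 2 / 4 * (1 - y ^ 2) by ring, mul_pow]
    ring
  simp only [eta1, chiStar_Icc_of_mem hy, h2, hF]
  rw [← tsum_mul_left, ← tsum_mul_left, ← tsum_mul_left]
  congr 1
  funext n
  ring

theorem integral_eta1 {c : ℝ} (hc : 0 < c) : ∫ y, eta1 c y = 1 := by
  have hs := Real.sinh_pos_iff.2 hc
  have h := hasSum_integral_mul_eta1 hc (g := fun _ => 1) continuous_const (fun _ => by norm_num)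
    (fun _ _ => le_rfl)
  simp only [one_mul] at h
  have hw : ∀ n : ℕ, ∫ y in (-1 : ℝ)..1, (1 - y ^ 2) ^ n = wallis n := fun _ => rfl
  simp only [hw, coeff_mul_wallis] at h
  have h2 := (Real.hasSum_sinh c).mul_left (Real.sinh c)⁻¹
  rw [inv_mul_cancel₀ hs.ne'] at h2
  refine h.unique (h2.congr_fun ?_)
  intro n
  rw [pow_succ]
  field_simp

theorem hasSum_integral_sq_mul_eta1 {c : ℝ} (hc : 0 < c) :
    HasSum (fun n : ℕ => c / Real.sinh c *
      (c ^ (2 * n) / ((2 * n + 1).factorial : ℝ) / (2 * n + 3))) (∫ y, y ^ 2 * eta1 c y) := by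
  have h := hasSum_integral_mul_eta1 hc (g := fun y => y ^ 2) (by fun_prop)
    (fun y => by positivity) (fun y hy => by rw [← sq_abs]; exact pow_le_one₀ (abs_nonneg y) hy)
  simp only [integral_sq_mul_one_sub_sq_pow] at h
  refine h.congr_fun ?_
  intro n
  have := coeff_mul_wallis c n
  calc _ = c / (2 * Real.sinh c) *
        ((2 * (c ^ (2 * n) / ((2 * n + 1).factorial : ℝ))) / (2 * n + 3)) := by
        field_simp
    _ = _ := by rw [← this]; ring

theorem integral_sq_mul_eta1_le_third {c : ℝ} (hc : 0 < c) :
    ∫ y, y ^ 2 * eta1 c y ≤ 1 / 3 := by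
  have hs := Real.sinh_pos_iff.2 hc
  have h2 := (Real.hasSum_sinh c).mul_left ((Real.sinh c)⁻¹ / 3)
  have e : (Real.sinh c)⁻¹ / 3 * Real.sinh c = 1 / 3 := by field_simp
  rw [e] at h2
  refine hasSum_le (fun n => ?_) (hasSum_integral_sq_mul_eta1 hc) h2
  have : c / Real.sinh c * (c ^ (2 * n) / ((2 * n + 1).factorial : ℝ) / (2 * n + 3)) ≤
      c / Real.sinh c * (c ^ (2 * n) / ((2 * n + 1).factorial : ℝ) / 3) := by
    gcongr
    have : (0 : ℝ) ≤ n := by positivity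
    linarith
  refine this.trans (le_of_eq ?_)
  rw [pow_succ]
  field_simp

/-- The second moment is `(c cosh c - sinh c) / (c² sinh c)`, and `c (cosh c - sinh c) = c e^{-c} ≤
c ≤ sinh c`. This is the source of the factor `1/c` in the bound for `A`. -/
theorem integral_sq_mul_eta1_le_inv {c : ℝ} (hc : 0 < c) :
    ∫ y, y ^ 2 * eta1 c y ≤ 1 / c := by
  have hs := Real.sinh_pos_iff.2 hc
  have h1 := ((Real.hasSum_cosh c).mul_left c).sub (Real.hasSum_sinh c)
  have h2 : HasSum (fun n : ℕ => c ^ 3 * (c ^ (2 * n) / ((2 * n + 1).factorial : ℝ) / (2 * n + 3)))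
      (c * Real.cosh c - Real.sinh c) := by
    -- The zeroth terms of `c cosh c` and `sinh c` cancel, so the index shifts by one.
    have h3 := (hasSum_nat_add_iff' 1).2 h1
    simp only [Finset.range_one, Finset.sum_singleton, mul_zero, pow_zero, Nat.factorial_zero,
      Nat.cast_one, div_one, zero_add, pow_one, Nat.factorial_one, mul_one, sub_self, sub_zero]
      at h3
    refine h3.congr_fun fun n => ?_
    have e1 : (2 * (n + 1) + 1).factorial = (2 * n + 3) * ((2 * n + 2) * (2 * n + 1).factorial) := by
      rw [show 2 * (n + 1) + 1 = (2 * n + 1) + 1 + 1 by ring, Nat.factorial_succ, Nat.factorial_succ]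
    have e2 : (2 * (n + 1)).factorial = (2 * n + 2) * (2 * n + 1).factorial := by
      rw [show 2 * (n + 1) = (2 * n + 1) + 1 by ring, Nat.factorial_succ]
    rw [e1, e2]
    push_cast
    have hf : ((2 * n + 1).factorial : ℝ) ≠ 0 := by positivity
    field_simp
    ring
  have h4 := h2.mul_left ((c ^ 2 * Real.sinh c)⁻¹)
  have h5 : ∫ y, y ^ 2 * eta1 c y = (c ^ 2 * Real.sinh c)⁻¹ * (c * Real.cosh c - Real.sinh c) := by
    refine (hasSum_integral_sq_mul_eta1 hc).unique (h4.congr_fun fun n => ?_)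
    field_simp
  have h6 : c * Real.cosh c - Real.sinh c ≤ c * Real.sinh c := by
    have e1 : Real.cosh c - Real.sinh c = Real.exp (-c) := Real.cosh_sub_sinh c
    have e2 : c ≤ Real.sinh c := Real.self_le_sinh_iff.2 hc.le
    have e3 : Real.exp (-c) ≤ 1 := Real.exp_le_one_iff.2 (by linarith)
    nlinarith
  rw [h5]
  calc _ ≤ (c ^ 2 * Real.sinh c)⁻¹ * (c * Real.sinh c) := by gcongr
    _ = 1 / c := by field_simp

theorem integral_mul_eta {c ε : ℝ} (hε : 0 < ε) (g : ℝ → ℝ) :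
    ∫ y, g y * eta c ε y = ∫ y, g (ε * y) * eta1 c y := by
  have h := Measure.integral_comp_div (fun y => ε⁻¹ * (g (ε * y) * eta1 c y)) ε
  rw [integral_const_mul ε⁻¹ (fun y => g (ε * y) * eta1 c y), smul_eq_mul, abs_of_pos hε,
    ← mul_assoc, mul_inv_cancel₀ hε.ne', one_mul] at h
  rw [← h]
  congr 1
  funext y
  rw [mul_div_cancel₀ _ hε.ne', eta]
  ring

theorem isKernel_eta {c ε : ℝ} (hc : 0 < c) (hε : 0 < ε) : IsKernel (eta c ε) ε where
  integrable := by
    have h := integrable_mul_eta1 hc (g := fun _ => 1) continuous_const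
    simp only [one_mul] at h
    exact (h.comp_div hε.ne').const_mul (1 / ε)
  nonneg y := mul_nonneg (by positivity) (eta1_nonneg hc _)
  even y := by simp only [eta, neg_div, eta1_neg]
  supp y hy := by
    rw [eta, eta1_of_lt_abs c, mul_zero]
    rwa [abs_div, abs_of_pos hε, one_lt_div hε]
  mass := by
    have h := integral_mul_eta (c := c) hε (fun _ => 1)
    simp only [one_mul] at h
    rw [h, integral_eta1 hc]
  second := by
    rw [integral_mul_eta hε (fun y => y ^ 2)]
    simp only [mul_pow, mul_assoc]
    rw [integral_const_mul]
    have := integral_sq_mul_eta1_le_third hc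
    nlinarith [sq_nonneg ε]

theorem integral_sq_mul_eta_le {c ε : ℝ} (hc : 0 < c) (hε : 0 < ε) :
    ∫ y, y ^ 2 * eta c ε y ≤ ε ^ 2 / c := by
  rw [integral_mul_eta hε (fun y => y ^ 2)]
  simp only [mul_pow, mul_assoc]
  rw [integral_const_mul, div_eq_mul_one_div]
  have := integral_sq_mul_eta1_le_inv hc
  gcongr

/-! ### The constants `λ`, `A` and the weight of a prime power -/

section Weights

variable {c ε : ℝ}

theorem lam_eq (c ε : ℝ) : lam c ε = ∫ y, Real.exp (-y / 2) * eta c ε y := by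
  have h : ell c ε (Complex.I / 2) = ((∫ y, Real.exp (-y / 2) * eta c ε y : ℝ) : ℂ) := by
    rw [ell, fourierHat, ← integral_complex_ofReal]
    congr 1
    funext t
    have e : Complex.I * (Complex.I / 2) * (t : ℂ) = ((-t / 2 : ℝ) : ℂ) := by
      push_cast
      linear_combination (t : ℂ) / 2 * Complex.I_mul_I
    rw [e, ← Complex.ofReal_exp]
    push_cast
    ring
  rw [lam, h, Complex.ofReal_re]

/-- `ℓ(ξ)` is the complex moment generating function of the measure `η(y) dy` at `iξ`. It is entire
by compact support, and its second derivative brings down `(i y)² = -y²`. -/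
theorem coeffA_eq (hc : 0 < c) (hε : 0 < ε) :
    coeffA c ε = (∫ y, y ^ 2 * eta c ε y) / 2 := by
  have hk := isKernel_eta hc hε
  have hmeas : Measurable (eta c ε) := by
    have := measurable_eta1 c
    unfold eta
    fun_prop
  set ρ : Measure ℝ := volume.withDensity fun y => ENNReal.ofReal (eta c ε y) with hρ
  have hint : ∀ g : ℝ → ℂ, ∫ y, g y ∂ρ = ∫ y, (eta c ε y : ℂ) * g y := by
    intro g
    rw [hρ, integral_withDensity_eq_integral_toReal_smul (by fun_prop) (by simp)]
    simp only [ENNReal.toReal_ofReal (hk.nonneg _), Complex.real_smul]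
  have hset : ProbabilityTheory.integrableExpSet id ρ = Set.univ := by
    refine Set.eq_univ_of_forall fun t => ?_
    show Integrable (fun y => Real.exp (t * id y)) ρ
    rw [hρ, integrable_withDensity_iff_integrable_smul' (by fun_prop) (by simp)]
    simp only [ENNReal.toReal_ofReal (hk.nonneg _), smul_eq_mul, id]
    have : Integrable fun y => Real.exp (t * y) * eta c ε y :=
      hk.integrable_of_continuous (by fun_prop)
    simpa only [mul_comm] using this
  have hmem : ∀ z : ℂ, z.re ∈ interior (ProbabilityTheory.integrableExpSet id ρ) := by
    simp [hset]
  have hell : ell c ε = fun ξ => ProbabilityTheory.complexMGF id ρ (Complex.I * ξ) := by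
    funext ξ
    rw [ell, fourierHat, ProbabilityTheory.complexMGF, hint]
    rfl
  have hdiff : Differentiable ℂ (ProbabilityTheory.complexMGF id ρ) := fun z =>
    (ProbabilityTheory.hasDerivAt_complexMGF (hmem z)).differentiableAt
  have hval : iteratedDeriv 2 (ell c ε) 0 = ((-∫ y, y ^ 2 * eta c ε y : ℝ) : ℂ) := by
    rw [hell, iteratedDeriv_comp_const_mul hdiff.contDiff]
    simp only [mul_zero]
    rw [ProbabilityTheory.iteratedDeriv_complexMGF (hmem 0), hint, Complex.I_sq,
      Complex.ofReal_neg, ← integral_complex_ofReal, neg_one_mul]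
    congr 2
    funext y
    simp only [id, zero_mul, Complex.exp_zero, mul_one]
    push_cast
    ring
  rw [coeffA, hval, ← Complex.ofReal_neg, neg_neg]
  norm_cast

theorem integral_sq_eq_two_mul_coeffA (hc : 0 < c) (hε : 0 < ε) :
    ∫ y, y ^ 2 * eta c ε y = 2 * coeffA c ε := by
  rw [coeffA_eq hc hε]; ring

theorem coeffA_nonneg (hc : 0 < c) (hε : 0 < ε) : 0 ≤ coeffA c ε := by
  have := (isKernel_eta hc hε).integral_second_nonneg
  rw [coeffA_eq hc hε]
  positivity

theorem coeffA_le (hc : 0 < c) (hε : 0 < ε) : coeffA c ε ≤ ε ^ 2 / (2 * c) := by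
  have := integral_sq_mul_eta_le hc hε
  rw [coeffA_eq hc hε]
  calc _ ≤ ε ^ 2 / c / 2 := by gcongr
    _ = _ := by field_simp

theorem one_le_lam (hc : 0 < c) (hε : 0 < ε) (hε' : ε ≤ 1 / 10 ^ 3) : 1 ≤ lam c ε := by
  rw [lam_eq]
  exact (isKernel_eta hc hε).one_le_integral_exp hε.le hε'

/-- The truncated integral of `transferKernel` against the kernel `η_{c,ε}`. -/
noncomputable def truncated (c ε t u : ℝ) : ℝ :=
  ∫ y in Set.Ici u, transferKernel t⁻¹ (coeffA c ε) y * eta c ε y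

/-- Substitute `s = t - y`: the cut-off `s ≤ log x` becomes `y ≥ t - log x`. Since `t > ε`, the
point `t - y` stays positive on the support of `η`, so the values of `f_k` at nonpositive arguments
play no role. -/
theorem phi_eq (hc : 0 < c) (hε : 0 < ε) (x : ℝ) {t : ℝ} (ht : ε < t) :
    t * Real.exp (-t / 2) * phi x c ε t =
      (lam c ε)⁻¹ * truncated c ε t (t - Real.log x) := by
  have hk := isKernel_eta hc hε
  set g : ℝ → ℝ := fun s => f 1 s + coeffA c ε * (f 2 s - 2 * f 3 s) with hg
  have hconv : convolution ((Set.Iic (Real.log x)).indicator g) (eta c ε)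
      (ContinuousLinearMap.mul ℝ ℝ) volume t =
      ∫ y, (Set.Iic (Real.log x)).indicator g (t - y) * eta c ε y := by
    rw [convolution_def]
    have := integral_sub_left_eq_self
      (fun s => (Set.Iic (Real.log x)).indicator g s * eta c ε (t - s)) volume t
    simp only [sub_sub_cancel] at this
    rw [this]
    rfl
  rw [phi, hconv, truncated, ← integral_indicator measurableSet_Ici, mul_left_comm,
    ← integral_const_mul]
  congr 1
  refine integral_congr_ae (Filter.Eventually.of_forall fun y => ?_)
  by_cases hy : |y| ≤ ε
  · have hty : t - y ≠ 0 := by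
      have := (abs_le.1 hy).2
      linarith
    by_cases h : t - y ≤ Real.log x
    · have h' : y ∈ Set.Ici (t - Real.log x) := by rw [Set.mem_Ici]; linarith
      simp only [Set.indicator_of_mem h', Set.indicator_of_mem (Set.mem_Iic.2 h)]
      rw [transferKernel_inv_eq _ (by linarith) hty]
      ring
    · have h' : y ∉ Set.Ici (t - Real.log x) := by rw [Set.mem_Ici]; linarith
      simp only [Set.indicator_of_notMem h', Set.indicator_of_notMem (mt Set.mem_Iic.1 h)]
      ring
  · have := hk.supp y (not_le.1 hy)
    simp [Set.indicator, this]

theorem truncated_of_le (hc : 0 < c) (hε : 0 < ε) (t : ℝ) {u : ℝ} (hu : ε ≤ u) :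
    truncated c ε t u = 0 := by
  -- When `u = ε`, the kernel need not vanish at the endpoint, which is a null set.
  rw [truncated, integral_Ici_eq_integral_Ioi]
  refine setIntegral_eq_zero_of_forall_eq_zero fun y hy => ?_
  rw [Set.mem_Ioi] at hy
  rw [(isKernel_eta hc hε).supp y (lt_abs.2 (Or.inl (by linarith))), mul_zero]

theorem truncated_of_le_neg (hc : 0 < c) (hε : 0 < ε) (t : ℝ) {u : ℝ} (hu : u ≤ -ε) :
    truncated c ε t u = ∫ y, transferKernel t⁻¹ (coeffA c ε) y * eta c ε y := by
  refine setIntegral_eq_integral_of_forall_compl_eq_zero fun y hy => ?_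
  rw [Set.mem_Ici, not_le] at hy
  rw [(isKernel_eta hc hε).supp y (lt_abs.2 (Or.inr (by linarith))), mul_zero]

theorem abs_inv_lam_mul_le (hc : 0 < c) (hε : 0 < ε) (hε' : ε ≤ 1 / 10 ^ 3) (X : ℝ) :
    |(lam c ε)⁻¹ * X| ≤ |X| := by
  have h := one_le_lam hc hε hε'
  rw [abs_mul, abs_of_nonneg (by positivity)]
  exact mul_le_of_le_one_left (abs_nonneg _) (inv_le_one_of_one_le₀ h)

/-- The weight of prime powers well below `x` is close to one. -/
theorem abs_far_sub_one_le (hc : 0 < c) (hε : 0 < ε) (hε' : ε ≤ 1 / 10 ^ 3) {t u : ℝ}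
    (ht : 0.69 ≤ t) (hu : u ≤ -ε) :
    |(lam c ε)⁻¹ * truncated c ε t u - 1| ≤ 16 * ε ^ 2 * coeffA c ε * t⁻¹ := by
  have h1 := one_le_lam hc hε hε'
  have e : (lam c ε)⁻¹ * truncated c ε t u - 1 = (lam c ε)⁻¹ * (truncated c ε t u - lam c ε) := by
    field_simp
  rw [e]
  refine (abs_inv_lam_mul_le hc hε hε' _).trans ?_
  rw [truncated_of_le_neg hc hε t hu, lam_eq]
  refine (isKernel_eta hc hε).abs_integral_transferKernel_sub_le hε' (by positivity) ?_
    (integral_sq_eq_two_mul_coeffA hc hε)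
  -- The bound 1.45 on `s` in the expansions is chosen to exceed `1/0.69`, hence `1/log 2`.
  rw [inv_le_comm₀ (by linarith) (by norm_num)]
  norm_num at ht ⊢
  linarith

/-- Near `x` the weight is given by the normalized counting weight `w` and the correction term
`M`, up to `A / 8` and smaller terms. -/
theorem abs_near_sub_le (hc : 0 < c) (hε : 0 < ε) (hε' : ε ≤ 1 / 10 ^ 3) {t u w : ℝ}
    (ht : 9.9 ≤ t)
    (hw : (u < 0 ∧ w = 1) ∨ (u = 0 ∧ w = 1 / 2) ∨ (0 < u ∧ w = 0)) :
    |(lam c ε)⁻¹ * truncated c ε t u - w - (lam c ε)⁻¹ *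
      (mu c ε u + (1 / t - 1 / 2) * (mu c ε u * u - nu c ε u))| ≤ 0.127 * coeffA c ε := by
  have hk := isKernel_eta hc hε
  have hA := integral_sq_eq_two_mul_coeffA hc hε
  have hA0 := coeffA_nonneg hc hε
  have h1 := one_le_lam hc hε hε'
  have ht0 : 0 < t := by linarith
  have hs : 0 < t⁻¹ := by positivity
  have hs' : t⁻¹ ≤ 0.11 := by
    rw [inv_le_comm₀ ht0 (by norm_num)]
    norm_num at ht ⊢
    linarith
  have e : (lam c ε)⁻¹ * truncated c ε t u - w - (lam c ε)⁻¹ *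
      (mu c ε u + (1 / t - 1 / 2) * (mu c ε u * u - nu c ε u)) =
      (lam c ε)⁻¹ * (truncated c ε t u - lam c ε * w - (mu c ε u +
        (t⁻¹ - 1 / 2) * ∫ y in Set.Ici u, y * eta c ε y)) := by
    rw [mu_mul_sub_nu hk hε, one_div t]
    field_simp
  rw [e]
  refine (abs_inv_lam_mul_le hc hε hε' _).trans ?_
  have hmain := abs_le.1 (hk.abs_integral_Ici_transferKernel_sub_le hε.le hε' hs hs' hA u)
  have hlam := abs_le.1 (hk.abs_integral_exp_sub_le hε')
  rw [← lam_eq, hA] at hlam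
  have hε2 : ε ^ 2 * coeffA c ε ≤ 0.001 * coeffA c ε := by
    norm_num at hε'
    gcongr
    nlinarith
  rw [truncated]
  have iQ := hk.integrable_quadPart t⁻¹ (coeffA c ε)
  -- By the choice of `w`, `∫_{y ≥ u} η = w + μ(u)`. What remains is the integral of `quadPart` over
  -- `[u, ∞)` minus `w (λ - 1)`, about `w A/4`: minus a left tail for `u < 0`, zero for `u = 0`, a
  -- right tail for `u > 0`. Each is at most `A/8` in size; the rest of `0.127 A` covers the
  -- remainders.
  rcases hw with ⟨hu, rfl⟩ | ⟨rfl, rfl⟩ | ⟨hu, rfl⟩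
  · have hq := hk.integral_Ici_quadPart_mem hs hs' hA (u := -u) (by linarith)
    have h2 := hk.integral_comp_neg_Ici (IsKernel.quadPart t⁻¹ (coeffA c ε)) (-u)
    have hev : ∀ y, IsKernel.quadPart t⁻¹ (coeffA c ε) (-y) =
        IsKernel.quadPart t⁻¹ (coeffA c ε) y := fun y => by simp only [IsKernel.quadPart]; ring
    simp only [hev, neg_neg] at h2
    have h3 := IsKernel.integral_Iic_add_Ici iQ u
    rw [hk.integral_quadPart hA] at h3
    have h4 := IsKernel.integral_Iic_add_Ici hk.integrable u
    rw [hk.mass] at h4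
    rw [mu_of_neg hu, abs_le]
    constructor <;> linarith
  · have hq := hk.integral_Ici_zero_of_even (g := IsKernel.quadPart t⁻¹ (coeffA c ε))
      (fun y => by simp only [IsKernel.quadPart]; ring) iQ
    rw [hk.integral_quadPart hA] at hq
    have h0 := hk.integral_Ici_zero_of_even (g := fun _ => 1) (fun _ => rfl)
      (by simpa using hk.integrable)
    simp only [one_mul] at h0
    rw [hk.mass] at h0
    rw [mu_zero, abs_le]
    constructor <;> linarith
  · have hq := hk.integral_Ici_quadPart_mem hs hs' hA hu.le
    rw [mu_of_pos hk hu, abs_le]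
    constructor <;> linarith

end Weights

/-! ### Assembling the error term -/

open Classical in
/-- The normalized weight with which a prime power is counted by `piStar`. -/
noncomputable def countWeight (x : ℝ) (q : PP) : ℝ :=
  (1 / 2) * (if q.val < x then 1 else 0) + (1 / 2) * (if q.val ≤ x then 1 else 0)

theorem log_div_val {x : ℝ} (hx : 0 < x) (q : PP) :
    Real.log (q.val / x) = Real.log q.val - Real.log x :=
  Real.log_div (by linarith [q.two_le_val]) hx.ne'

theorem log_two_le_log_val (q : PP) : 0.69 ≤ Real.log q.val := by
  have h1 := Real.log_two_gt_d9
  have h2 := Real.log_le_log (by norm_num) q.two_le_val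
  linarith

/-- With `t = m log p`, the factor `log p / p^{m/2}` is `(1/m) t e^{-t/2}`. -/
theorem piModTerm_eq {x c ε : ℝ} (hc : 0 < c) (hε : 0 < ε) (hε' : ε ≤ 1 / 10 ^ 3) (q : PP) :
    piModTerm x c ε q = 1 / (q.m : ℝ) * ((lam c ε)⁻¹ *
      truncated c ε (Real.log q.val) (Real.log q.val - Real.log x)) := by
  have hp : 0 < q.p := by linarith [q.two_le_p]
  have hm : (0 : ℝ) < q.m := by exact_mod_cast q.m_pos
  have ht := log_two_le_log_val q
  rw [← phi_eq hc hε x (by norm_num at hε'; linarith), piModTerm, ← q.log_val,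
    Real.rpow_def_of_pos hp]
  have e : -Real.log q.val / 2 = -(Real.log q.p * ((q.m : ℝ) / 2)) := by rw [q.log_val]; ring
  rw [e, Real.exp_neg, q.log_val]
  field_simp

/-- This lets the contribution of squares and higher powers, of order `ε √x log log (2x²)`, be
absorbed into `ε x / log (ε x)`. -/
theorem log_mul_log_log_le {x : ℝ} (hx : Real.exp 10 < x) :
    Real.log x * Real.log (Real.log (2 * x ^ 2)) ≤ 1.2 * √x := by
  have hx0 : 0 < x := (Real.exp_pos _).trans hx
  have hL : 10 < Real.log x := (Real.lt_log_iff_exp_lt hx0).2 hx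
  have hs0 : 0 < √x := Real.sqrt_pos.2 hx0
  have hLs : Real.log √x = Real.log x / 2 := Real.log_sqrt hx0.le
  have hlog2x : Real.log (2 * x ^ 2) = Real.log 2 + 2 * Real.log x := by
    rw [Real.log_mul (by norm_num) (by positivity), Real.log_pow]; norm_num
  have hlog2 := Real.log_two_lt_d9
  have hlog2' := Real.log_two_gt_d9
  have hy : 0 < Real.log (2 * x ^ 2) := by rw [hlog2x]; linarith
  -- The tangent to the logarithm at `e³` gives `log y ≤ y/e³ + 2`, and `e³ ≥ 20`.
  have hLL : Real.log (Real.log (2 * x ^ 2)) ≤ Real.log (2 * x ^ 2) / 20 + 2 := by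
    have h3 : (20 : ℝ) ≤ Real.exp 3 := by
      have h := Real.exp_one_gt_d9
      have : Real.exp 3 = Real.exp 1 ^ 3 := by rw [← Real.exp_nat_mul]; norm_num
      rw [this]
      calc (20 : ℝ) ≤ 2.718 ^ 3 := by norm_num
        _ ≤ _ := by gcongr; linarith
    have h1 := Real.log_le_sub_one_of_pos (div_pos hy (Real.exp_pos 3))
    rw [Real.log_div hy.ne' (Real.exp_pos 3).ne', Real.log_exp] at h1
    have h2 : Real.log (2 * x ^ 2) / Real.exp 3 ≤ Real.log (2 * x ^ 2) / 20 := by gcongr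
    linarith
  set v := Real.log x / 2 with hv
  have hv5 : 5 < v := by rw [hv]; linarith
  have hexp := Real.sum_le_exp_of_nonneg (x := v) (by linarith) 4
  rw [← hLs, Real.exp_log hs0, hLs] at hexp
  simp [Finset.sum_range_succ, Nat.factorial] at hexp
  have hLL2 : Real.log (Real.log (2 * x ^ 2)) ≤ 0.2 * v + 2.04 := by
    rw [hlog2x] at hLL ⊢
    linarith
  have : Real.log x = 2 * v := by rw [hv]; ring
  rw [this]
  have h3 : 5 * v ^ 2 ≤ v ^ 3 := by nlinarith [sq_nonneg v]
  calc 2 * v * Real.log (Real.log (2 * x ^ 2)) ≤ 2 * v * (0.2 * v + 2.04) := by gcongr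
    _ ≤ _ := by nlinarith

/-- With `A ≤ ε²/(2c)`, primes near `x` cost `0.127 · 7.2 / 2 = 0.4572` units of `ε³ x / (c log (ε
x))`, higher powers at most 0.08, and prime powers well below `x` at most 0.024; together these are
below 0.57. The isolated double logarithm gives the last term, and the term with `39 ε⁴ x / c³` is
pure slack. -/
theorem error_bound {x c ε A : ℝ} (hx : Real.exp 10 < x) (hc : 1 ≤ c) (hε : x⁻¹ < ε)
    (hε' : ε ≤ 1 / 10 ^ 3) (hA0 : 0 ≤ A) (hA : A ≤ ε ^ 2 / (2 * c)) :
    0.127 * A * (7.2 * (ε * x) / Real.log (ε * x) +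
      (1 + 1.01 * ε * √x) * Real.log (Real.log (2 * x ^ 2))) +
      16 * ε ^ 2 * A * (3 * x / Real.log x) ≤
    0.57 * ε ^ 3 * x / (c * Real.log (ε * x)) + 39 * ε ^ 4 * x / c ^ 3 +
      0.13 * ε ^ 2 * Real.log (Real.log (2 * x ^ 2)) / c := by
  have hx0 : 0 < x := (Real.exp_pos _).trans hx
  have hε0 : 0 < ε := (inv_pos.2 hx0).trans hε
  have hc0 : 0 < c := by linarith
  have hL : 10 < Real.log x := (Real.lt_log_iff_exp_lt hx0).2 hx
  have hh : 1 < ε * x := by rwa [inv_lt_iff_one_lt_mul₀ hx0] at hε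
  have hl : 0 < Real.log (ε * x) := Real.log_pos hh
  have hε1 : ε ≤ 0.001 := by norm_num at hε' ⊢; linarith
  have hlL : Real.log (ε * x) ≤ Real.log x := by
    apply Real.log_le_log (by positivity)
    nlinarith
  have hlog2x : Real.log (2 * x ^ 2) = Real.log 2 + 2 * Real.log x := by
    rw [Real.log_mul (by norm_num) (by positivity), Real.log_pow]; norm_num
  have hLL0 : 0 ≤ Real.log (Real.log (2 * x ^ 2)) := by
    apply Real.log_nonneg
    rw [hlog2x]
    have := Real.log_two_gt_d9
    linarith
  have hLL := log_mul_log_log_le hx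
  have hss : √x * √x = x := Real.mul_self_sqrt hx0.le
  set LL := Real.log (Real.log (2 * x ^ 2)) with hLLdef
  set L := Real.log x
  set l := Real.log (ε * x)
  set E := ε ^ 3 * x / (c * l) with hE
  have hE0 : 0 < E := by positivity
  have hxl : √x * LL ≤ 1.2 * x / l := by
    rw [le_div_iff₀ hl]
    calc √x * LL * l ≤ √x * LL * L := by gcongr
      _ = √x * (L * LL) := by ring
      _ ≤ √x * (1.2 * √x) := by gcongr
      _ = 1.2 * (√x * √x) := by ring
      _ = 1.2 * x := by rw [hss]
  have t1 : 0.127 * A * (7.2 * (ε * x) / l) ≤ 0.4572 * E := by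
    calc _ ≤ 0.127 * (ε ^ 2 / (2 * c)) * (7.2 * (ε * x) / l) := by gcongr
      _ = _ := by rw [hE]; field_simp; norm_num
  have t2 : 0.127 * A * LL ≤ 0.13 * ε ^ 2 * LL / c := by
    calc _ ≤ 0.127 * (ε ^ 2 / (2 * c)) * LL := by gcongr
      _ = 0.0635 * (ε ^ 2 * LL / c) := by field_simp; ring
      _ ≤ 0.13 * (ε ^ 2 * LL / c) := by gcongr; norm_num
      _ = _ := by ring
  have t3 : 0.127 * A * (1.01 * ε * √x * LL) ≤ 0.08 * E := by
    calc _ = 0.127 * A * (1.01 * ε * (√x * LL)) := by ring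
      _ ≤ 0.127 * (ε ^ 2 / (2 * c)) * (1.01 * ε * (1.2 * x / l)) := by gcongr
      _ = 0.076962 * E := by rw [hE]; field_simp; norm_num
      _ ≤ _ := by gcongr; norm_num
  have t4 : 16 * ε ^ 2 * A * (3 * x / L) ≤ 0.024 * E := by
    calc _ ≤ 16 * (ε * 0.001) * (ε ^ 2 / (2 * c)) * (3 * x / l) := by
          have : ε ^ 2 ≤ ε * 0.001 := by rw [sq]; gcongr
          gcongr
      _ = _ := by rw [hE]; field_simp; norm_num
  have t5 : 0 ≤ 39 * ε ^ 4 * x / c ^ 3 := by positivity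
  have e1 : 0.57 * ε ^ 3 * x / (c * l) = 0.57 * E := by rw [hE]; ring
  rw [e1]
  calc _ = 0.127 * A * (7.2 * (ε * x) / l) + 0.127 * A * LL + 0.127 * A * (1.01 * ε * √x * LL) +
        16 * ε ^ 2 * A * (3 * x / L) := by ring
    _ ≤ _ := by linarith

theorem piMod_eq_piStar_add_shortSum_add (x c ε : ℝ) (hx : Real.exp 10 < x) (hc : 1 ≤ c) (hε : x⁻¹ < ε)
    (hε' : ε ≤ 1 / 10 ^ 3) :
    Summable (LoganPi.piModTerm x c ε) ∧
      ∃ R : ℝ,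
        LoganPi.piMod c ε x = LoganPi.piStar x + LoganPi.shortSum x c ε + R ∧
        |R| ≤ 0.57 * ε ^ 3 * x / (c * Real.log (ε * x)) + 39 * ε ^ 4 * x / c ^ 3 +
          0.13 * ε ^ 2 * Real.log (Real.log (2 * x ^ 2)) / c := by
  classical
  have hx0 : 0 < x := (Real.exp_pos _).trans hx
  have hε0 : 0 < ε := (inv_pos.2 hx0).trans hε
  have hc0 : 0 < c := by linarith
  have hL : 10 < Real.log x := (Real.lt_log_iff_exp_lt hx0).2 hx
  have hA0 := coeffA_nonneg hc0 hε0
  have hexp1 : 1 < Real.exp ε := Real.one_lt_exp_iff.2 hε0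
  have hexp2 : Real.exp (-ε) < 1 := Real.exp_lt_one_iff.2 (by linarith)
  have hxlt : x < Real.exp ε * x := by nlinarith
  have hltx : Real.exp (-ε) * x < x := by nlinarith
  -- Beyond `e^ε x` every summand vanishes, so all the series are finite sums over `F`.
  set F := (finite_setOf_val_le (Real.exp ε * x)).toFinset with hF
  have hnotF : ∀ q ∉ F, Real.exp ε * x < q.val := by
    intro q hq
    simpa [hF] using hq
  have hterm : ∀ q : PP, piModTerm x c ε q = 1 / (q.m : ℝ) * ((lam c ε)⁻¹ *
      truncated c ε (Real.log q.val) (Real.log q.val - Real.log x)) :=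
    fun q => piModTerm_eq hc0 hε0 hε' q
  have hlogb : ∀ q : PP, Real.exp ε * x ≤ q.val → ε ≤ Real.log q.val - Real.log x := by
    intro q hq
    have := Real.log_le_log (by positivity) hq
    rw [Real.log_mul (Real.exp_pos _).ne' hx0.ne', Real.log_exp] at this
    linarith
  have hzero : ∀ q ∉ F, piModTerm x c ε q = 0 := by
    intro q hq
    rw [hterm, truncated_of_le hc0 hε0 _ (hlogb q (hnotF q hq).le)]
    simp
  refine ⟨summable_of_ne_finset_zero hzero, piMod c ε x - piStar x - shortSum x c ε, by ring, ?_⟩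
  set near : PP → Prop := fun q => Real.exp (-ε) * x < q.val ∧ q.val < Real.exp ε * x with hnear
  -- `D q` is the error in the weight of one prime power, with the common factor `1/m` removed.
  set D : PP → ℝ := fun q => (lam c ε)⁻¹ *
      truncated c ε (Real.log q.val) (Real.log q.val - Real.log x) - countWeight x q -
        (if near q then bigM x c ε q.val else 0) with hD
  have hR : piMod c ε x - piStar x - shortSum x c ε = ∑ q ∈ F, 1 / (q.m : ℝ) * D q := by
    have h1 : piMod c ε x = ∑ q ∈ F, piModTerm x c ε q := tsum_eq_sum hzero
    have h2 : (∑' q : PP, if q.val < x then 1 / (q.m : ℝ) else 0) =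
        ∑ q ∈ F, if q.val < x then 1 / (q.m : ℝ) else 0 :=
      tsum_eq_sum fun q hq => if_neg (by linarith [hnotF q hq])
    have h3 : (∑' q : PP, if q.val ≤ x then 1 / (q.m : ℝ) else 0) =
        ∑ q ∈ F, if q.val ≤ x then 1 / (q.m : ℝ) else 0 :=
      tsum_eq_sum fun q hq => if_neg (by linarith [hnotF q hq])
    have h4 : shortSum x c ε = ∑ q ∈ F, if near q then
        1 / (q.m : ℝ) * bigM x c ε q.val else 0 :=
      tsum_eq_sum fun q hq => if_neg fun h => by linarith [hnotF q hq, h.2]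
    rw [h1, h4, piStar, h2, h3, Finset.mul_sum, Finset.mul_sum, ← Finset.sum_add_distrib,
      ← Finset.sum_sub_distrib, ← Finset.sum_sub_distrib]
    refine Finset.sum_congr rfl fun q _ => ?_
    simp only [hterm, hD, countWeight]
    split_ifs <;> ring
  have hm1 : ∀ q : PP, (1 : ℝ) ≤ q.m := fun q => by exact_mod_cast q.m_pos
  have hnearD : ∀ q : PP, near q → |D q| ≤ 0.127 * coeffA c ε := by
    intro q hq
    have ht : 9.9 ≤ Real.log q.val := by
      have := Real.log_le_log (by positivity) hq.1.le
      rw [Real.log_mul (Real.exp_pos _).ne' hx0.ne', Real.log_exp] at this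
      norm_num at hε' ⊢
      linarith
    have hq0 : 0 < q.val := by linarith [q.two_le_val]
    simp only [hD, if_pos hq, bigM, log_div_val hx0]
    refine abs_near_sub_le hc0 hε0 hε' ht ?_
    rcases lt_trichotomy q.val x with h | h | h
    · exact Or.inl ⟨sub_neg.2 (Real.log_lt_log hq0 h), by
        rw [countWeight, if_pos h, if_pos h.le]; norm_num⟩
    · exact Or.inr (Or.inl ⟨by rw [h, sub_self], by
        rw [countWeight, if_neg h.not_lt, if_pos h.le]; norm_num⟩)
    · exact Or.inr (Or.inr ⟨sub_pos.2 (Real.log_lt_log hx0 h), by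
        rw [countWeight, if_neg (not_lt.2 h.le), if_neg (not_le.2 h)]; norm_num⟩)
  have hfarD : ∀ q : PP, q.val ≤ Real.exp (-ε) * x →
      |D q| ≤ 16 * ε ^ 2 * coeffA c ε * (Real.log q.val)⁻¹ := by
    intro q hq
    have hn : ¬ near q := fun h => by linarith [h.1]
    have hw : countWeight x q = 1 := by
      have : q.val < x := by linarith
      rw [countWeight, if_pos this, if_pos this.le]; norm_num
    simp only [hD, if_neg hn, hw, sub_zero]
    refine abs_far_sub_one_le hc0 hε0 hε' (log_two_le_log_val q) ?_
    have := Real.log_le_log (by linarith [q.two_le_val]) hq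
    rw [Real.log_mul (Real.exp_pos _).ne' hx0.ne', Real.log_exp] at this
    linarith
  -- The case of equality is needed: a prime power equal to `e^ε x` would lie in `F` but not in the
  -- open interval.
  have hbeyondD : ∀ q : PP, Real.exp ε * x ≤ q.val → D q = 0 := by
    intro q hq
    have hn : ¬ near q := fun h => by linarith [h.2]
    have hw : countWeight x q = 0 := by
      have : x < q.val := by linarith
      rw [countWeight, if_neg (not_lt.2 this.le), if_neg (not_le.2 this)]; norm_num
    simp only [hD, if_neg hn, hw, truncated_of_le hc0 hε0 _ (hlogb q hq)]
    ring
  have hnearsum := sum_inv_m_near_le hx hε hε' (F.filter near)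
    (fun q hq => (Finset.mem_filter.1 hq).2)
  have hfarsum := sum_inv_log_val_le hx (F.filter fun q => q.val ≤ Real.exp (-ε) * x)
    (fun q hq => (Finset.mem_filter.1 hq).2.trans hltx.le)
  rw [hR]
  calc |∑ q ∈ F, 1 / (q.m : ℝ) * D q| ≤ ∑ q ∈ F, |1 / (q.m : ℝ) * D q| :=
        Finset.abs_sum_le_sum_abs _ _
    _ ≤ ∑ q ∈ F, ((if near q then 0.127 * coeffA c ε * (1 / (q.m : ℝ)) else 0) +
        if q.val ≤ Real.exp (-ε) * x then
          16 * ε ^ 2 * coeffA c ε * (Real.log q.val)⁻¹ else 0) := by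
        refine Finset.sum_le_sum fun q _ => ?_
        have hm := hm1 q
        rw [abs_mul, abs_of_nonneg (by positivity : (0 : ℝ) ≤ 1 / q.m)]
        by_cases hn : near q
        · rw [if_pos hn, if_neg (not_le.2 hn.1), add_zero, mul_comm]
          gcongr
          exact hnearD q hn
        · rw [if_neg hn, zero_add]
          by_cases hf : q.val ≤ Real.exp (-ε) * x
          · rw [if_pos hf]
            -- Far from `x` the factor `1/m ≤ 1` is simply discarded.
            refine (mul_le_of_le_one_left (abs_nonneg _) ?_).trans (hfarD q hf)
            rw [div_le_one (by linarith)]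
            exact hm
          · rw [if_neg hf, hbeyondD q]
            · simp
            · by_contra h
              exact hn ⟨not_le.1 hf, not_le.1 h⟩
    _ = 0.127 * coeffA c ε * (∑ q ∈ F.filter near, 1 / (q.m : ℝ)) +
        16 * ε ^ 2 * coeffA c ε *
          ∑ q ∈ F.filter (fun q => q.val ≤ Real.exp (-ε) * x), (Real.log q.val)⁻¹ := by
        rw [Finset.sum_add_distrib, ← Finset.sum_filter, ← Finset.sum_filter, ← Finset.mul_sum,
          ← Finset.mul_sum]
    _ ≤ _ := add_le_add (mul_le_mul_of_nonneg_left hnearsum (by positivity))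
        (mul_le_mul_of_nonneg_left hfarsum (by positivity))
    _ ≤ _ := error_bound hx hc hε hε' hA0 (coeffA_le hc0 hε0)

end LoganPi

theorem theorem1 (x c ε : ℝ) (hx : Real.exp 10 < x) (hc : 1 ≤ c) (hε : x⁻¹ < ε)
    (hε' : ε ≤ 1 / 10 ^ 3) :
    Summable (LoganPi.piModTerm x c ε) ∧
      ∃ R : ℝ,
        LoganPi.piMod c ε x = LoganPi.piStar x + LoganPi.shortSum x c ε + R ∧
        |R| ≤ 0.57 * ε ^ 3 * x / (c * Real.log (ε * x)) + 39 * ε ^ 4 * x / c ^ 3 +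
          0.13 * ε ^ 2 * Real.log (Real.log (2 * x ^ 2)) / c :=
  LoganPi.piMod_eq_piStar_add_shortSum_add x c ε hx hc hε hε'
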